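/- Let $W,T>0$, $\rho_W(x)=\frac{\sin Wx}{\pi x}$, and let $(\mathcal B_W\mathcal D_Tf)(t)=\int_{-T}^{T}\rho_W(t-s)f(s)\,ds$. The nonzero eigenvalues of $\mathcal B_W\mathcal D_T$ on $L^2(\mathbb R)$ are simple and are enumerated decreasingly, $\gamma_0>\gamma_1>\dots>0$. Let $\xi_n$ be a real eigenfunction, $\mathcal B_W\mathcal D_T\xi_n=\gamma_n\xi_n$ on all of $\mathbb R$, normalized by $\int_{\mathbb R}\xi_n^2=1$ (the $n$-th $W,T$-prolate). Write $\|f\|_T^2=\int_{-T}^{T}f^2$, $\|f\|_{>T}^2=\int_{|t|>T}f^2$ and $\|f\|_\infty^2=\int_{\mathbb R}f^2$ (so $\|\cdot\|_\infty$ is the $L^2(\mathbb R)$ norm). Then $0<\gamma_n<1$, $\xi_n$ is smooth with $\xi_n'\in L^2(\mathbb R)$, there is a unique $\lambda_n\in\mathbb R$ with $$(T^2-t^2)\xi_n''(t)-2t\,\xi_n'(t)+W^2(T^2-t^2)\xi_n(t)=-\lambda_n\xi_n(t)\qquad(t\in\mathbb R),$$ and $\|\xi_n'\|_\infty<W$.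 Put $$C_{\mathrm{extra},n}=\sqrt{\|\xi_n'\|_\infty^2-\tfrac{\lambda_n}{T}\tfrac{\xi_n(T)^2}{1-\gamma_n}},\quad C_{\mathrm{intra},n}=\sqrt{\|\xi_n'\|_\infty^2+\tfrac{\lambda_n}{T}\tfrac{\xi_n(T)^2}{\gamma_n}},$$ $$\tilde C_{\mathrm{intra},n}=C_{\mathrm{intra},n}+\delta_{n0}\tfrac{\xi_0(T)^2}{\gamma_0},\quad C_n=\sqrt{\|\xi_n'\|_\infty^2+\tfrac{\lambda_n^2}{4T^2}}.$$ The following hold. 1. $\|\xi_n'\|_T^2=\gamma_n\,C_{\mathrm{intra},n}^2$ and $\|\xi_n'\|_{>T}^2=(1-\gamma_n)\,C_{\mathrm{extra},n}^2$. 2. $\sup_{|t|\ge T}\xi_n(t)^2\le(1-\gamma_n)\,C_{\mathrm{extra},n}$ and $\sup_{|t|\le T}\xi_n(t)^2\le\gamma_n\,\tilde C_{\mathrm{intra},n}$. 3. If $\lambda_n<0$, then $C_{\mathrm{extra},n}\le C_n-\frac{\lambda_n}{2T}$, $C_{\mathrm{extra},n}\le W\bigl(\sqrt{1+c^2/4}+c/2\bigr)$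 with $c=WT$, and $C_{\mathrm{intra},n}<\|\xi_n'\|_\infty<W$. If $\lambda_n\ge0$, then $C_{\mathrm{extra},n}\le\|\xi_n'\|_\infty<W$ and $C_{\mathrm{intra},n}\le C_n+\frac{\lambda_n}{2T}$. 4. There are absolute constants $K$ and $c_0>0$ such that for all $W,T>0$ with $c=WT\ge c_0$ and all $n$ with $\lambda_n<0$, $C_{\mathrm{extra},n}<W\bigl(c+c^{-1}+Kc^{-2}\bigr)$. -/

import Mathlib

open MeasureTheory
open scoped ContDiff

/-- The sampling function `ρ_W(x) = sin (W x) / (π x)`, with value `W / π` at `x = 0`. -/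
noncomputable def samplingKernel (W x : ℝ) : ℝ := W / Real.pi * Real.sinc (W * x)

/-- The operator `B_W D_T` (truncation to `[-T, T]` followed by band limiting to `[-W, W]`):
`(B_W D_T f)(t) = ∫_{-T}^{T} ρ_W(t - s) f(s) ds`. -/
noncomputable def bandTimeLimit (W T : ℝ) (f : ℝ → ℝ) (t : ℝ) : ℝ :=
  ∫ s in (-T)..T, samplingKernel W (t - s) * f s

/-- `f` is a nonzero square integrable eigenfunction of `B_W D_T` with nonzero eigenvalue `γ`.
The equation is imposed at every point, which selects the smooth representative. -/
def IsProlateEigenfunction (W T γ : ℝ) (f : ℝ → ℝ) : Prop :=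
  γ ≠ 0 ∧ MemLp f 2 volume ∧ f ≠ 0 ∧ ∀ t : ℝ, bandTimeLimit W T f t = γ * f t

/-- `ξ` is an `n`-th `W,T`-prolate, normalized in `L²(ℝ)`, with eigenvalue `γ = γ_n`: it is an
eigenfunction of `B_W D_T` whose eigenvalue is preceded by exactly `n` larger ones. (The nonzero
eigenvalues are simple, so that they are enumerated as `γ_0 > γ_1 > γ_2 > ⋯ > 0`.) -/
def IsProlate (W T : ℝ) (n : ℕ) (γ : ℝ) (ξ : ℝ → ℝ) : Prop :=
  IsProlateEigenfunction W T γ ξ ∧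
  (∫ t : ℝ, ξ t ^ 2) = 1 ∧
  {γ' : ℝ | γ < γ' ∧ ∃ f : ℝ → ℝ, IsProlateEigenfunction W T γ' f}.encard = n

/-- The prolate spheroidal differential operator
`P_{WT} y = (T² - t²) y'' - 2 t y' + W² (T² - t²) y`. -/
noncomputable def prolateDiffOp (W T : ℝ) (y : ℝ → ℝ) (t : ℝ) : ℝ :=
  (T ^ 2 - t ^ 2) * deriv (deriv y) t - 2 * t * deriv y t + W ^ 2 * (T ^ 2 - t ^ 2) * y t

/-- `y` solves the prolate spheroidal wave equation `P_{WT} y = -lam y` on the real line. -/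
def SolvesPSWEq (W T lam : ℝ) (y : ℝ → ℝ) : Prop :=
  ∀ t : ℝ, prolateDiffOp W T y t = -lam * y t

/-- `‖f‖_T²`, the energy of `f` on `[-T, T]`. -/
noncomputable def energyInside (T : ℝ) (f : ℝ → ℝ) : ℝ := ∫ t in (-T)..T, f t ^ 2

/-- `‖f‖_{>T}²`, the energy of `f` on `{|t| > T}`. -/
noncomputable def energyOutside (T : ℝ) (f : ℝ → ℝ) : ℝ := ∫ t in {t : ℝ | T < |t|}, f t ^ 2

/-- `‖f‖_∞`, which here denotes the `L²` norm of `f` on the whole real line. -/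
noncomputable def lineNorm (f : ℝ → ℝ) : ℝ := Real.sqrt (∫ t : ℝ, f t ^ 2)

/-- `C_extra = √(‖ξ'‖_∞² - (λ / T) ξ(T)² / (1 - γ))`. -/
noncomputable def CExtra (T γ lam : ℝ) (ξ : ℝ → ℝ) : ℝ :=
  Real.sqrt (lineNorm (deriv ξ) ^ 2 - lam / T * (ξ T ^ 2 / (1 - γ)))

/-- `C_intra = √(‖ξ'‖_∞² + (λ / T) ξ(T)² / γ)`. -/
noncomputable def CIntra (T γ lam : ℝ) (ξ : ℝ → ℝ) : ℝ :=
  Real.sqrt (lineNorm (deriv ξ) ^ 2 + lam / T * (ξ T ^ 2 / γ))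

/-- `C̃_intra = C_intra + δ_{n0} ξ(T)² / γ`. -/
noncomputable def CIntraTilde (T : ℝ) (n : ℕ) (γ lam : ℝ) (ξ : ℝ → ℝ) : ℝ :=
  CIntra T γ lam ξ + if n = 0 then ξ T ^ 2 / γ else 0

/-- `C_n = √(‖ξ'‖_∞² + λ² / (4 T²))`. -/
noncomputable def CBase (T lam : ℝ) (ξ : ℝ → ℝ) : ℝ :=
  Real.sqrt (lineNorm (deriv ξ) ^ 2 + lam ^ 2 / (4 * T ^ 2))

/-!
Signals in the range of `B_W` are Fourier integrals of spectra supported in `[-W, W]`, so Plancherel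
turns `B_W D_T f = γ f` into `∫_{-T}^{T} f g = γ ∫ f g` for every such `g`, and differentiation into
multiplication by a factor bounded by `W`. The differential operator `P_{WT}` commutes with
`B_W D_T`, and where the order of vanishing at `T` is positive, `P_{WT}` lowers it by one. An
eigenfunction therefore cannot vanish at `T`, the eigenvalues are simple, and each eigenfunction is
even or odd and solves the prolate equation, whose value at `t = T` gives `f' T = λ f T / (2 T)`.
Integrating `(f f')'` over `[-T, T]` yields the energies of `f'`; the bounds on `f²` are the
Cauchy-Schwarz inequality for `∫ |(f²)'|`, taken symmetrically on both sides, starting at `∞` or at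
a zero of `f`.

A zero in `[-T, T]` exists for `n ≥ 1`: the most concentrated band-limited signal `p` has none, as
it could be divided out, `p / (t - z)` being still band-limited and more concentrated; and the
`n`-th prolate is orthogonal to `p` on `[-T, T]`. For `λ ≥ 0` the zero exists because the prolate is
orthogonal on `[-T, T]` to the positive weight `W² (T² - t²) + λ`.
-/

theorem integral_norm_sq_eq_lpNorm_sq {α F : Type*} [MeasurableSpace α] {μ : Measure α}
    [NormedAddCommGroup F] {f : α → F} (hf : AEStronglyMeasurable f μ) :
    ∫ x, ‖f x‖ ^ 2 ∂μ = lpNorm f 2 μ ^ 2 := by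
  have h_int : 0 ≤ ∫ x, ‖f x‖ ^ 2 ∂μ := integral_nonneg fun x => sq_nonneg _
  simp only [lpNorm_eq_integral_norm_rpow_toReal two_ne_zero ENNReal.ofNat_ne_top hf,
    ENNReal.toReal_ofNat, Real.rpow_ofNat]
  rw [← Real.rpow_natCast, ← Real.rpow_mul h_int, Nat.cast_ofNat, inv_mul_cancel₀ two_ne_zero,
    Real.rpow_one]

section Plancherel

open FourierTransform SchwartzMap

variable {E F : Type*} [NormedAddCommGroup E] [InnerProductSpace ℝ E] [FiniteDimensional ℝ E]
  [MeasurableSpace E] [BorelSpace E] [NormedAddCommGroup F] [InnerProductSpace ℂ F]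
  [CompleteSpace F] {g : E → F}

theorem fourier_toLp_two_ae_eq (hg : Integrable g) (hg2 : MemLp g 2) :
    (𝓕 (hg2.toLp g) : Lp F 2 (volume : Measure E)) =ᵐ[volume] 𝓕 g := by
  have hcont : Continuous (𝓕 g) :=
    VectorFourier.fourierIntegral_continuous Real.continuous_fourierChar
      (by exact continuous_inner) hg
  refine ae_eq_of_integral_contDiff_smul_eq
    ((Lp.memLp _).locallyIntegrable one_le_two) hcont.locallyIntegrable fun φ hφ hφc => ?_
  have hφc' : HasCompactSupport (fun x => (φ x : ℂ)) := hφc.comp_left Complex.ofReal_zero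
  let ψ : 𝓢(E, ℂ) := hφc'.toSchwartzMap (Complex.ofRealCLM.contDiff.comp hφ)
  have hψ (f : E → F) : ∫ x, φ x • f x = ∫ x, ψ x • f x :=
    integral_congr_ae (.of_forall fun x => (Complex.coe_smul (φ x) (f x)).symm)
  calc ∫ x, φ x • (𝓕 (hg2.toLp g) : Lp F 2 (volume : Measure E)) x
      = ∫ x, ψ x • (𝓕 (hg2.toLp g) : Lp F 2 (volume : Measure E)) x := hψ _
    _ = ∫ x, (𝓕 ψ) x • hg2.toLp g x := by
        simpa only [TemperedDistribution.fourier_apply, Lp.toTemperedDistribution_apply] using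
          (congrArg (fun D : 𝓢'(E, F) => D ψ)
            (Lp.fourier_toTemperedDistribution_eq (hg2.toLp g))).symm
    _ = ∫ x, 𝓕 (ψ : E → ℂ) x • g x := by
        refine integral_congr_ae ?_
        filter_upwards [hg2.coeFn_toLp] with x hx
        rw [hx, SchwartzMap.fourier_coe]
    _ = ∫ x, ψ x • 𝓕 g x := by
        have h := VectorFourier.integral_fourierIntegral_smul_eq_flip (L := innerₗ E)
          (μ := volume) (ν := volume) Real.continuous_fourierChar continuous_inner ψ.integrable hg
        rwa [flip_innerₗ] at h
    _ = ∫ x, φ x • 𝓕 g x := (hψ _).symm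

theorem memLp_two_fourier (hg : Integrable g) (hg2 : MemLp g 2) : MemLp (𝓕 g) 2 :=
  (memLp_congr_ae (fourier_toLp_two_ae_eq hg hg2)).1 (Lp.memLp _)

theorem eLpNorm_two_fourier (hg : Integrable g) (hg2 : MemLp g 2) :
    eLpNorm (𝓕 g) 2 = eLpNorm g 2 := by
  have h := Lp.norm_fourier_eq (hg2.toLp g)
  rwa [Lp.norm_toLp, Lp.norm_def, eLpNorm_congr_ae (fourier_toLp_two_ae_eq hg hg2),
    ENNReal.toReal_eq_toReal_iff' (memLp_two_fourier hg hg2).2.ne hg2.2.ne] at h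

theorem integral_norm_sq_fourier (hg : Integrable g) (hg2 : MemLp g 2) :
    ∫ x, ‖𝓕 g x‖ ^ 2 = ∫ x, ‖g x‖ ^ 2 := by
  have hF := memLp_two_fourier hg hg2
  rw [integral_norm_sq_eq_lpNorm_sq hF.1, integral_norm_sq_eq_lpNorm_sq hg2.1,
    ← toReal_eLpNorm hg2.1, ← toReal_eLpNorm hF.1, eLpNorm_two_fourier hg hg2]

end Plancherel

theorem hasDerivAt_intervalIntegral_of_continuous {𝕜 E : Type*} [RCLike 𝕜]
    [NormedAddCommGroup E] [NormedSpace ℝ E] [NormedSpace 𝕜 E] {K K' : 𝕜 → ℝ → E} {a b : ℝ}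
    (hK : Continuous (Function.uncurry K)) (hK' : Continuous (Function.uncurry K'))
    (h : ∀ z s, HasDerivAt (fun z => K z s) (K' z s) z) (z : 𝕜) :
    HasDerivAt (fun z => ∫ s in a..b, K z s) (∫ s in a..b, K' z s) z := by
  obtain ⟨C, hC⟩ := ((isCompact_closedBall z 1).prod
    (isCompact_uIcc (a := a) (b := b))).exists_bound_of_continuousOn hK'.continuousOn
  refine (intervalIntegral.hasDerivAt_integral_of_dominated_loc_of_deriv_le (F := K) (F' := K')
    (bound := fun _ => C) (s := Metric.closedBall z 1) (Metric.closedBall_mem_nhds z one_pos)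
    (.of_forall fun x => (hK.uncurry_left x).aestronglyMeasurable)
    ((hK.uncurry_left z).intervalIntegrable _ _) (hK'.uncurry_left z).aestronglyMeasurable
    (.of_forall fun t ht x hx => hC (x, t) ⟨hx, Set.uIoc_subset_uIcc ht⟩)
    intervalIntegrable_const (.of_forall fun t _ x _ => h x t)).2

theorem intervalIntegral_swap_of_continuous {E : Type*} [NormedAddCommGroup E] [NormedSpace ℝ E]
    {F : ℝ → ℝ → E} (hF : Continuous (Function.uncurry F)) (a b c d : ℝ) :
    ∫ x in a..b, ∫ y in c..d, F x y = ∫ y in c..d, ∫ x in a..b, F x y :=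
  intervalIntegral_intervalIntegral_swap
    ((hF.continuousOn.integrableOn_compact (isCompact_uIcc.prod isCompact_uIcc)).mono_set
      (Set.prod_mono Set.uIoc_subset_uIcc Set.uIoc_subset_uIcc))

theorem integral_mul_integral_comp_sub_mul {k f g : ℝ → ℝ} {ε : ℝ} (hk : Continuous k)
    (hε : ∀ x, k (-x) = ε * k x) (hf : Continuous f) (hg : Continuous g) (a b : ℝ) :
    ∫ t in a..b, g t * ∫ s in a..b, k (t - s) * f s =
      ε * ∫ t in a..b, f t * ∫ s in a..b, k (t - s) * g s := by
  simp only [← intervalIntegral.integral_const_mul]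
  rw [intervalIntegral_swap_of_continuous (by unfold Function.uncurry; fun_prop)]
  congr 1 with s
  congr 1 with t
  rw [← neg_sub s t, hε]
  ring

theorem hasDerivAt_integral_comp_sub_mul {k f : ℝ → ℝ} (hk : ContDiff ℝ 1 k) (hf : Continuous f)
    (a b t : ℝ) :
    HasDerivAt (fun t => ∫ s in a..b, k (t - s) * f s) (∫ s in a..b, deriv k (t - s) * f s) t := by
  have hk₀ := hk.continuous
  have := hk.continuous_deriv_one
  refine hasDerivAt_intervalIntegral_of_continuous (𝕜 := ℝ) (K := fun t s => k (t - s) * f s)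
    (K' := fun t s => deriv k (t - s) * f s)
    (by unfold Function.uncurry; fun_prop) (by unfold Function.uncurry; fun_prop) (fun z s => ?_) t
  exact ((hk.differentiable_one _).hasDerivAt.comp_sub_const z s).mul_const (f s)

section BandSynthesis

variable {W : ℝ} {a : ℝ → ℂ} {g : ℝ → ℝ}

/-- The Fourier integral `∫_{-W}^W a(w) e^{iwz} dw`, which extends the function on the real line
with spectral density `a` on the band `[-W, W]` to an entire function. -/
noncomputable def bandSynthesis (W : ℝ) (a : ℝ → ℂ) (z : ℂ) : ℂ :=
  ∫ w in (-W)..W, a w * Complex.exp (Complex.I * w * z)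

theorem hasDerivAt_bandSynthesis (W : ℝ) (ha : Continuous a) (z : ℂ) :
    HasDerivAt (bandSynthesis W a) (bandSynthesis W (fun w => Complex.I * w * a w) z) z := by
  refine hasDerivAt_intervalIntegral_of_continuous (𝕜 := ℂ)
    (K' := fun z w => Complex.I * w * a w * Complex.exp (Complex.I * w * z))
    (by unfold Function.uncurry; fun_prop) (by unfold Function.uncurry; fun_prop) (fun z w => ?_) z
  refine (((hasDerivAt_id' z).const_mul (Complex.I * w)).cexp.const_mul (a w)).congr_deriv ?_
  ring

theorem differentiable_bandSynthesis (W : ℝ) (ha : Continuous a) :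
    Differentiable ℂ (bandSynthesis W a) :=
  fun z => (hasDerivAt_bandSynthesis W ha z).differentiableAt

theorem integrable_indicator_band (W : ℝ) (ha : Continuous a) :
    Integrable ((Set.Ioc (-W) W).indicator a) :=
  ha.integrableOn_Ioc.integrable_indicator measurableSet_Ioc

theorem memLp_indicator_band (W : ℝ) (ha : Continuous a) :
    MemLp ((Set.Ioc (-W) W).indicator a) 2 := by
  rw [memLp_indicator_iff_restrict measurableSet_Ioc,
    memLp_two_iff_integrable_sq_norm ha.aestronglyMeasurable]
  exact (ha.norm.pow 2).integrableOn_Ioc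

open FourierTransform in
theorem bandSynthesis_eq_fourier (hW : 0 ≤ W) (a : ℝ → ℂ) (t : ℝ) :
    bandSynthesis W a t = 𝓕 ((Set.Ioc (-W) W).indicator a) (-(2 * Real.pi)⁻¹ * t) := by
  rw [bandSynthesis, intervalIntegral.integral_of_le (by linarith),
    Real.fourier_real_eq_integral_exp_smul, ← integral_indicator measurableSet_Ioc]
  congr 1 with w
  by_cases hw : w ∈ Set.Ioc (-W) W
  · simp only [Set.indicator_of_mem hw, smul_eq_mul]
    rw [mul_comm]
    congr 2
    push_cast
    field_simp
  · simp [Set.indicator_of_notMem hw]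

theorem memLp_bandSynthesis (hW : 0 ≤ W) (ha : Continuous a) :
    MemLp (fun t : ℝ => bandSynthesis W a t) 2 := by
  have hF := memLp_two_fourier (integrable_indicator_band W ha) (memLp_indicator_band W ha)
  have hcont : Continuous (fun t : ℝ => bandSynthesis W a t) :=
    (differentiable_bandSynthesis W ha).continuous.comp Complex.continuous_ofReal
  rw [memLp_two_iff_integrable_sq_norm hF.1] at hF
  rw [memLp_two_iff_integrable_sq_norm hcont.aestronglyMeasurable]
  simp only [bandSynthesis_eq_fourier hW]
  exact hF.comp_mul_left' (R := -(2 * Real.pi)⁻¹) (by simp [Real.pi_ne_zero])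

theorem integral_norm_sq_bandSynthesis (hW : 0 ≤ W) (ha : Continuous a) :
    ∫ t : ℝ, ‖bandSynthesis W a t‖ ^ 2 = 2 * Real.pi * ∫ w in (-W)..W, ‖a w‖ ^ 2 := by
  have hsq (w : ℝ) : ‖(Set.Ioc (-W) W).indicator a w‖ ^ 2 =
      (Set.Ioc (-W) W).indicator (fun w => ‖a w‖ ^ 2) w := by
    by_cases hw : w ∈ Set.Ioc (-W) W <;> simp [hw]
  simp only [bandSynthesis_eq_fourier hW]
  rw [Measure.integral_comp_mul_left
      (fun x => ‖FourierTransform.fourier ((Set.Ioc (-W) W).indicator a) x‖ ^ 2),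
    integral_norm_sq_fourier (integrable_indicator_band W ha) (memLp_indicator_band W ha),
    intervalIntegral.integral_of_le (by linarith), ← integral_indicator measurableSet_Ioc]
  simp [hsq, abs_of_pos Real.pi_pos]

/-- The spectral density `w ↦ (2π)⁻¹ ∫_{-T}^T f(s) e^{-iws} ds` of the truncation of `f` to
`[-T, T]`, normalized so that `B_W D_T f` is its synthesis over the band `[-W, W]`. -/
noncomputable def timeSpectrum (T : ℝ) (f : ℝ → ℝ) (w : ℝ) : ℂ :=
  (2 * Real.pi : ℂ)⁻¹ * ∫ s in (-T)..T, (f s : ℂ) * Complex.exp (-(Complex.I * w * s))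

theorem continuous_timeSpectrum (T : ℝ) {f : ℝ → ℝ} (hf : Continuous f) :
    Continuous (timeSpectrum T f) :=
  continuous_const.mul
    (intervalIntegral.continuous_parametric_intervalIntegral_of_continuous' (by fun_prop) _ _)

theorem integral_mul_bandSynthesis (W T : ℝ) {f : ℝ → ℝ} (hf : Continuous f) (ha : Continuous a) :
    ∫ t in (-T)..T, (f t : ℂ) * bandSynthesis W a t =
      2 * Real.pi * ∫ w in (-W)..W, a w * (starRingEnd ℂ) (timeSpectrum T f w) := by
  simp only [bandSynthesis, ← intervalIntegral.integral_const_mul]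
  rw [intervalIntegral_swap_of_continuous (by unfold Function.uncurry; fun_prop)]
  congr 1 with w
  have hconj : (starRingEnd ℂ) (timeSpectrum T f w) =
      (2 * Real.pi : ℂ)⁻¹ * ∫ t in (-T)..T, (f t : ℂ) * Complex.exp (Complex.I * w * t) := by
    rw [timeSpectrum, map_mul, ← intervalIntegral.intervalIntegral_conj]
    simp [← Complex.exp_conj, Complex.conj_ofNat]
  rw [hconj, mul_left_comm, mul_inv_cancel_left₀ (by simp [Real.pi_ne_zero]),
    ← intervalIntegral.integral_const_mul]
  congr 1 with t
  ring

/-- `g` is the real function with continuous spectral density `a` on the band `[-W, W]`. -/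
structure HasBandSpectrum (W : ℝ) (a : ℝ → ℂ) (g : ℝ → ℝ) : Prop where
  continuous_spectrum : Continuous a
  eq_bandSynthesis : ∀ t : ℝ, (g t : ℂ) = bandSynthesis W a t

namespace HasBandSpectrum

theorem analyticAt (h : HasBandSpectrum W a g) (t : ℝ) : AnalyticAt ℝ g t := by
  have hsyn : AnalyticAt ℝ (bandSynthesis W a) (Complex.ofRealCLM t) :=
    ((differentiable_bandSynthesis W h.continuous_spectrum).analyticAt _).restrictScalars
  refine ((Complex.reCLM.analyticAt _).comp (hsyn.comp (Complex.ofRealCLM.analyticAt t))).congr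
    (.of_forall fun s => ?_)
  simp [← h.eq_bandSynthesis]

theorem contDiff {n : WithTop ℕ∞} (h : HasBandSpectrum W a g) : ContDiff ℝ n g :=
  contDiff_iff_contDiffAt.2 fun t => (h.analyticAt t).contDiffAt

theorem continuous (h : HasBandSpectrum W a g) : Continuous g :=
  h.contDiff.continuous (n := 0)

protected theorem deriv (h : HasBandSpectrum W a g) :
    HasBandSpectrum W (fun w => Complex.I * w * a w) (deriv g) where
  continuous_spectrum := by have := h.continuous_spectrum; fun_prop
  eq_bandSynthesis t := by
    have hsyn := (hasDerivAt_bandSynthesis W h.continuous_spectrum t).comp_ofReal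
    simp only [← h.eq_bandSynthesis] at hsyn
    exact (h.analyticAt t).differentiableAt.hasDerivAt.ofReal_comp.unique hsyn

theorem memLp_two (hW : 0 ≤ W) (h : HasBandSpectrum W a g) : MemLp g 2 := by
  refine (memLp_bandSynthesis hW h.continuous_spectrum).re.congr_norm
    h.continuous.aestronglyMeasurable (.of_forall fun t => ?_)
  simp [← h.eq_bandSynthesis]

theorem integral_sq (hW : 0 ≤ W) (h : HasBandSpectrum W a g) :
    ∫ t, g t ^ 2 = 2 * Real.pi * ∫ w in (-W)..W, ‖a w‖ ^ 2 := by
  rw [← integral_norm_sq_bandSynthesis hW h.continuous_spectrum]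
  simp [← h.eq_bandSynthesis]

theorem integral_deriv_sq (hW : 0 ≤ W) (h : HasBandSpectrum W a g) :
    ∫ t, deriv g t ^ 2 = 2 * Real.pi * ∫ w in (-W)..W, w ^ 2 * ‖a w‖ ^ 2 := by
  simp [h.deriv.integral_sq hW, mul_pow]

/-- A strict form of Bernstein's inequality for band-limited functions. -/
theorem integral_deriv_sq_lt (hW : 0 ≤ W) (h : HasBandSpectrum W a g) (hg : g ≠ 0) :
    ∫ t, deriv g t ^ 2 < W ^ 2 * ∫ t, g t ^ 2 := by
  have ha := h.continuous_spectrum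
  obtain ⟨w, hw, haw⟩ : ∃ w ∈ Set.Ioo (-W) W, a w ≠ 0 := by
    by_contra! hzero
    refine hg (funext fun t => ?_)
    have hsyn : bandSynthesis W a t = 0 := by
      rw [bandSynthesis, intervalIntegral.integral_of_le (by linarith),
        integral_Ioc_eq_integral_Ioo]
      exact setIntegral_eq_zero_of_forall_eq_zero fun w hw => by simp [hzero w hw]
    simpa [← h.eq_bandSynthesis] using hsyn
  rw [h.integral_sq hW, h.integral_deriv_sq hW, mul_left_comm]
  refine mul_lt_mul_of_pos_left ?_ Real.two_pi_pos
  rw [← intervalIntegral.integral_const_mul]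
  refine intervalIntegral.integral_lt_integral_of_continuousOn_of_le_of_exists_lt
    (hw.1.trans hw.2) (by fun_prop) (by fun_prop) (fun x hx => ?_) ⟨w, ⟨hw.1.le, hw.2.le⟩, ?_⟩
  · exact mul_le_mul_of_nonneg_right (sq_le_sq' hx.1.le hx.2) (by positivity)
  · exact mul_lt_mul_of_pos_right (sq_lt_sq' hw.1 hw.2) (by positivity)

end HasBandSpectrum

end BandSynthesis

section SamplingKernel

variable {W T : ℝ} {f u v : ℝ → ℝ}

theorem samplingKernel_neg (W x : ℝ) : samplingKernel W (-x) = samplingKernel W x := by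
  simp [samplingKernel]

theorem deriv_samplingKernel_neg (W x : ℝ) :
    deriv (samplingKernel W) (-x) = -deriv (samplingKernel W) x := by
  rw [← neg_eq_iff_eq_neg, ← deriv_comp_neg]
  simp only [samplingKernel_neg]

theorem deriv_deriv_samplingKernel_neg (W x : ℝ) :
    deriv (deriv (samplingKernel W)) (-x) = deriv (deriv (samplingKernel W)) x := by
  rw [← neg_inj, ← deriv_comp_neg]
  simp only [deriv_samplingKernel_neg, deriv.fun_neg]

theorem abs_samplingKernel_le (W x : ℝ) : |samplingKernel W x| ≤ |W| / Real.pi := by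
  rw [samplingKernel, abs_mul, abs_div, abs_of_pos Real.pi_pos]
  exact mul_le_of_le_one_right (by positivity) (Real.abs_sinc_le_one _)

theorem mul_samplingKernel (W x : ℝ) : x * samplingKernel W x = Real.sin (W * x) / Real.pi := by
  rcases eq_or_ne (W * x) 0 with h | h
  · rcases mul_eq_zero.1 h with h | h <;> simp [samplingKernel, h]
  · have hW := left_ne_zero_of_mul h
    have hx := right_ne_zero_of_mul h
    rw [samplingKernel, Real.sinc_of_ne_zero h]
    field_simp

theorem hasBandSpectrum_samplingKernel (W : ℝ) :
    HasBandSpectrum W (fun _ => (2 * Real.pi : ℂ)⁻¹) (samplingKernel W) where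
  continuous_spectrum := continuous_const
  eq_bandSynthesis x := by
    have hexp (w : ℝ) : Complex.exp (Complex.I * w * x) =
        Complex.exp (((w * x : ℝ) : ℂ) * Complex.I) := by
      congr 1
      push_cast
      ring
    rw [bandSynthesis, intervalIntegral.integral_const_mul]
    simp only [hexp]
    rcases eq_or_ne x 0 with rfl | hx
    · simp only [samplingKernel, mul_zero, Real.sinc_zero, mul_one, Complex.ofReal_div, mul_inv_rev,
        Complex.ofReal_zero, zero_mul, Complex.exp_zero, intervalIntegral.integral_const,
        sub_neg_eq_add, Complex.real_smul, Complex.ofReal_add]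
      field_simp
      norm_num
    · rw [intervalIntegral.integral_comp_mul_right (fun y : ℝ => Complex.exp (y * Complex.I)) hx,
        neg_mul, integral_exp_mul_I_eq_sinc, samplingKernel]
      have hx' : (x : ℂ) ≠ 0 := by exact_mod_cast hx
      simp only [Complex.real_smul]
      push_cast
      field_simp

theorem continuous_samplingKernel (W : ℝ) : Continuous (samplingKernel W) :=
  (hasBandSpectrum_samplingKernel W).continuous

theorem hasBandSpectrum_bandTimeLimit (W T : ℝ) (hf : Continuous f) :
    HasBandSpectrum W (timeSpectrum T f) (bandTimeLimit W T f) where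
  continuous_spectrum := continuous_timeSpectrum T hf
  eq_bandSynthesis t := by
    have hker (s : ℝ) : ((samplingKernel W (t - s) * f s : ℝ) : ℂ) = ∫ w in (-W)..W,
        (2 * Real.pi : ℂ)⁻¹ * (f s * Complex.exp (-(Complex.I * w * s))
          * Complex.exp (Complex.I * w * t)) := by
      rw [Complex.ofReal_mul, (hasBandSpectrum_samplingKernel W).eq_bandSynthesis, bandSynthesis,
        ← intervalIntegral.integral_mul_const]
      congr 1 with w
      rw [mul_assoc (f s : ℂ), ← Complex.exp_add]
      push_cast
      ring_nf
    rw [bandTimeLimit, ← intervalIntegral.integral_ofReal]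
    simp only [hker]
    rw [intervalIntegral_swap_of_continuous (by unfold Function.uncurry; fun_prop), bandSynthesis]
    congr 1 with w
    rw [intervalIntegral.integral_const_mul, intervalIntegral.integral_mul_const, timeSpectrum,
      mul_assoc (2 * (Real.pi : ℂ))⁻¹]

theorem continuous_bandTimeLimit (W : ℝ) (hf : IntervalIntegrable f volume (-T) T) :
    Continuous (bandTimeLimit W T f) := by
  have hρ := continuous_samplingKernel W
  refine intervalIntegral.continuous_of_dominated_interval
    (bound := fun s => |W| / Real.pi * |f s|) (fun t => ?_) (fun t => .of_forall fun s _ => ?_)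
    (hf.abs.const_mul _) (.of_forall fun s _ => by fun_prop)
  · exact (hρ.comp (continuous_sub_left t)).aestronglyMeasurable.mul hf.def'.aestronglyMeasurable
  · rw [Real.norm_eq_abs, abs_mul]
    exact mul_le_mul_of_nonneg_right (abs_samplingKernel_le W _) (abs_nonneg _)

theorem samplingKernel_ode (W x : ℝ) :
    x * deriv (deriv (samplingKernel W)) x + 2 * deriv (samplingKernel W) x
      + W ^ 2 * x * samplingKernel W x = 0 := by
  have hρ := hasBandSpectrum_samplingKernel W
  have hd (y : ℝ) := (hρ.analyticAt y).differentiableAt.hasDerivAt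
  have hdd (y : ℝ) := (hρ.deriv.analyticAt y).differentiableAt.hasDerivAt
  have hlin (y : ℝ) : HasDerivAt (fun y => W * y) W y := by
    simpa using (hasDerivAt_id y).const_mul W
  have hfirst (y : ℝ) : samplingKernel W y + y * deriv (samplingKernel W) y =
      Real.cos (W * y) * W / Real.pi := by
    have h := (hasDerivAt_id' y).fun_mul (hd y)
    simp only [mul_samplingKernel] at h
    linarith [h.unique ((hlin y).sin.div_const Real.pi)]
  have h := (hd x).fun_add ((hasDerivAt_id' x).fun_mul (hdd x))
  simp only [hfirst] at h
  linear_combination h.unique (((hlin x).cos.mul_const W).div_const Real.pi) +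
    W ^ 2 * mul_samplingKernel W x

theorem prolateDiffOp_samplingKernel_sub_comm (W T s t : ℝ) :
    prolateDiffOp W T (fun s => samplingKernel W (t - s)) s =
      prolateDiffOp W T (fun t => samplingKernel W (t - s)) t := by
  have hleft : deriv (fun s => samplingKernel W (t - s)) =
      fun s => -deriv (samplingKernel W) (t - s) := funext fun s => deriv_comp_const_sub ..
  have hright : deriv (fun t => samplingKernel W (t - s)) =
      fun t => deriv (samplingKernel W) (t - s) := funext fun t => deriv_comp_sub_const ..
  simp only [prolateDiffOp, hleft, hright, deriv.fun_neg, deriv_comp_const_sub,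
    deriv_comp_sub_const]
  linear_combination (t + s) * samplingKernel_ode W (t - s)

theorem contDiff_one_deriv (hu : ContDiff ℝ 2 u) : ContDiff ℝ 1 (deriv u) :=
  (contDiff_succ_iff_deriv.1 (one_add_one_eq_two (R := WithTop ℕ∞) ▸ hu)).2.2

theorem continuous_prolateDiffOp (W T : ℝ) (hu : ContDiff ℝ 2 u) :
    Continuous (prolateDiffOp W T u) := by
  have hu₀ := hu.continuous
  have hu₁ := hu.continuous_deriv one_le_two
  have := (contDiff_one_deriv hu).continuous_deriv_one
  unfold prolateDiffOp
  fun_prop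

theorem hasDerivAt_mul_deriv_prolate {t : ℝ} (T : ℝ)
    (hu : DifferentiableAt ℝ (deriv u) t) :
    HasDerivAt (fun t => (T ^ 2 - t ^ 2) * deriv u t)
      ((T ^ 2 - t ^ 2) * deriv (deriv u) t - 2 * t * deriv u t) t := by
  refine (((hasDerivAt_pow 2 t).const_sub (T ^ 2)).fun_mul hu.hasDerivAt).congr_deriv ?_
  ring

/-- The boundary term of the integration by parts vanishes because the leading coefficient
`T² - t²` does. -/
theorem integral_prolateDiffOp_mul (W T : ℝ) (hu : ContDiff ℝ 2 u) (hv : ContDiff ℝ 1 v) :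
    ∫ t in (-T)..T, prolateDiffOp W T u t * v t =
      ∫ t in (-T)..T, (W ^ 2 * (T ^ 2 - t ^ 2) * (u t * v t) -
        (T ^ 2 - t ^ 2) * (deriv u t * deriv v t)) := by
  have hu₀ := hu.continuous
  have hu₁ := hu.continuous_deriv one_le_two
  have := (contDiff_one_deriv hu).continuous_deriv_one
  have hv₀ := hv.continuous
  have hv₁ := hv.continuous_deriv_one
  have hparts := intervalIntegral.integral_deriv_mul_eq_sub (a := -T) (b := T)
    (fun t _ => hasDerivAt_mul_deriv_prolate T ((contDiff_one_deriv hu).differentiable_one t))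
    (fun t _ => (hv.differentiable_one t).hasDerivAt)
    (Continuous.intervalIntegrable (by fun_prop) _ _) (hv₁.intervalIntegrable _ _)
  simp only [neg_sq, sub_self, zero_mul] at hparts
  rw [← sub_eq_zero, ← hparts, ← intervalIntegral.integral_sub
    (((continuous_prolateDiffOp W T hu).fun_mul hv₀).intervalIntegrable _ _)
    (Continuous.intervalIntegrable (by fun_prop) _ _)]
  congr 1 with t
  rw [prolateDiffOp]
  ring

theorem integral_prolateDiffOp_mul_comm (W T : ℝ) (hu : ContDiff ℝ 2 u) (hv : ContDiff ℝ 2 v) :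
    ∫ t in (-T)..T, prolateDiffOp W T u t * v t = ∫ t in (-T)..T, prolateDiffOp W T v t * u t := by
  rw [integral_prolateDiffOp_mul W T hu (hv.of_le one_le_two),
    integral_prolateDiffOp_mul W T hv (hu.of_le one_le_two)]
  simp only [mul_comm (u _), mul_comm (deriv u _)]

theorem prolateDiffOp_bandTimeLimit (W T : ℝ) (hf : ContDiff ℝ 2 f) (t : ℝ) :
    prolateDiffOp W T (bandTimeLimit W T f) t = bandTimeLimit W T (prolateDiffOp W T f) t := by
  have hρ := hasBandSpectrum_samplingKernel W
  have hf₀ := hf.continuous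
  have hρ₀ := hρ.continuous
  have hρ₁ := hρ.deriv.continuous
  have hρ₂ := hρ.deriv.deriv.continuous
  have hderiv : deriv (bandTimeLimit W T f) =
      fun t => ∫ s in (-T)..T, deriv (samplingKernel W) (t - s) * f s :=
    funext fun t => (hasDerivAt_integral_comp_sub_mul hρ.contDiff hf₀ _ _ t).deriv
  have hright (s : ℝ) : deriv (fun t => samplingKernel W (t - s)) =
      fun t => deriv (samplingKernel W) (t - s) := funext fun t => deriv_comp_sub_const ..
  calc prolateDiffOp W T (bandTimeLimit W T f) t
      = ∫ s in (-T)..T, prolateDiffOp W T (fun t => samplingKernel W (t - s)) t * f s := by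
        rw [prolateDiffOp, hderiv,
          (hasDerivAt_integral_comp_sub_mul hρ.deriv.contDiff hf₀ _ _ t).deriv, bandTimeLimit]
        simp only [← intervalIntegral.integral_const_mul]
        rw [← intervalIntegral.integral_sub (Continuous.intervalIntegrable (by fun_prop) _ _)
          (Continuous.intervalIntegrable (by fun_prop) _ _), ← intervalIntegral.integral_add
          (Continuous.intervalIntegrable (by fun_prop) _ _)
          (Continuous.intervalIntegrable (by fun_prop) _ _)]
        congr 1 with s
        simp only [prolateDiffOp, hright, deriv_comp_sub_const]
        ring
    _ = ∫ s in (-T)..T, prolateDiffOp W T (fun s => samplingKernel W (t - s)) s * f s := by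
        simp only [prolateDiffOp_samplingKernel_sub_comm]
    _ = ∫ s in (-T)..T, prolateDiffOp W T f s * samplingKernel W (t - s) :=
        integral_prolateDiffOp_mul_comm W T (hρ.contDiff.comp (by fun_prop)) hf
    _ = bandTimeLimit W T (prolateDiffOp W T f) t := by simp only [bandTimeLimit, mul_comm]

end SamplingKernel

theorem HasBandSpectrum.const_mul {W : ℝ} {a : ℝ → ℂ} {g : ℝ → ℝ} (c : ℝ)
    (h : HasBandSpectrum W a g) : HasBandSpectrum W (fun w => c * a w) fun t => c * g t where
  continuous_spectrum := continuous_const.mul h.continuous_spectrum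
  eq_bandSynthesis t := by
    simp only [Complex.ofReal_mul, h.eq_bandSynthesis, bandSynthesis, mul_assoc,
      intervalIntegral.integral_const_mul]

/-- Membership in the eigenspace of `B_W D_T` for the nonzero eigenvalue `γ`, with the continuous
representative selected. The zero function is allowed, so that this is a linear space. -/
structure IsBandTimeEigen (W T γ : ℝ) (f : ℝ → ℝ) : Prop where
  ne_zero : γ ≠ 0
  continuous : Continuous f
  bandTimeLimit_eq : ∀ t, bandTimeLimit W T f t = γ * f t

theorem IsProlateEigenfunction.isBandTimeEigen {W T γ : ℝ} {f : ℝ → ℝ}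
    (h : IsProlateEigenfunction W T γ f) : IsBandTimeEigen W T γ f := by
  obtain ⟨hγ, hf, -, heq⟩ := h
  have h_int : IntervalIntegrable f volume (-T) T :=
    ((hf.locallyIntegrable (by norm_num)).integrableOn_isCompact isCompact_uIcc).intervalIntegrable
  refine ⟨hγ, ?_, heq⟩
  have hf_eq : f = fun t => γ⁻¹ * bandTimeLimit W T f t :=
    funext fun t => by rw [heq, inv_mul_cancel_left₀ hγ]
  rw [hf_eq]
  exact (continuous_bandTimeLimit W h_int).const_mul _

namespace IsBandTimeEigen

variable {W T γ γ' : ℝ} {f g : ℝ → ℝ}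

theorem hasBandSpectrum (h : IsBandTimeEigen W T γ f) :
    HasBandSpectrum W (fun w => ((γ⁻¹ : ℝ) : ℂ) * timeSpectrum T f w) f := by
  have hf_eq : f = fun t => γ⁻¹ * bandTimeLimit W T f t :=
    funext fun t => by rw [h.bandTimeLimit_eq, inv_mul_cancel_left₀ h.ne_zero]
  conv => arg 3; rw [hf_eq]
  exact (hasBandSpectrum_bandTimeLimit W T h.continuous).const_mul _

theorem analyticAt (h : IsBandTimeEigen W T γ f) (t : ℝ) : AnalyticAt ℝ f t :=
  h.hasBandSpectrum.analyticAt t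

theorem contDiff {n : WithTop ℕ∞} (h : IsBandTimeEigen W T γ f) : ContDiff ℝ n f :=
  h.hasBandSpectrum.contDiff

theorem memLp_two (hW : 0 ≤ W) (h : IsBandTimeEigen W T γ f) : MemLp f 2 :=
  h.hasBandSpectrum.memLp_two hW

theorem memLp_two_deriv (hW : 0 ≤ W) (h : IsBandTimeEigen W T γ f) : MemLp (deriv f) 2 :=
  h.hasBandSpectrum.deriv.memLp_two hW

theorem hasDerivAt (h : IsBandTimeEigen W T γ f) (t : ℝ) : HasDerivAt f (deriv f t) t :=
  (h.analyticAt t).differentiableAt.hasDerivAt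

theorem hasDerivAt_deriv (h : IsBandTimeEigen W T γ f) (t : ℝ) :
    HasDerivAt (deriv f) (deriv (deriv f) t) t :=
  (h.hasBandSpectrum.deriv.analyticAt t).differentiableAt.hasDerivAt

theorem continuous_deriv (h : IsBandTimeEigen W T γ f) : Continuous (deriv f) :=
  h.hasBandSpectrum.deriv.continuous

theorem continuous_deriv_deriv (h : IsBandTimeEigen W T γ f) : Continuous (deriv (deriv f)) :=
  h.hasBandSpectrum.deriv.deriv.continuous

theorem sub_const_mul (c : ℝ) (hg : IsBandTimeEigen W T γ g) (hf : IsBandTimeEigen W T γ f) :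
    IsBandTimeEigen W T γ fun t => g t - c * f t where
  ne_zero := hf.ne_zero
  continuous := hg.continuous.sub (hf.continuous.const_mul c)
  bandTimeLimit_eq t := by
    have hρ := continuous_samplingKernel W
    have hf₀ := hf.continuous
    have hg₀ := hg.continuous
    have hlin : bandTimeLimit W T (fun t => g t - c * f t) t =
        bandTimeLimit W T g t - c * bandTimeLimit W T f t := by
      simp only [bandTimeLimit, ← intervalIntegral.integral_const_mul]
      rw [← intervalIntegral.integral_sub (Continuous.intervalIntegrable (by fun_prop) _ _)
        (Continuous.intervalIntegrable (by fun_prop) _ _)]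
      congr 1 with s
      ring
    rw [hlin, hg.bandTimeLimit_eq, hf.bandTimeLimit_eq]
    ring

theorem comp_neg (h : IsBandTimeEigen W T γ f) : IsBandTimeEigen W T γ fun t => f (-t) where
  ne_zero := h.ne_zero
  continuous := h.continuous.comp continuous_neg
  bandTimeLimit_eq t := by
    rw [← h.bandTimeLimit_eq, bandTimeLimit, bandTimeLimit]
    conv_rhs => rw [← neg_neg T, ← intervalIntegral.integral_comp_neg, neg_neg]
    congr 1 with s
    rw [← samplingKernel_neg, neg_sub, sub_neg_eq_add, neg_add_eq_sub]

theorem prolateDiffOp (h : IsBandTimeEigen W T γ f) :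
    IsBandTimeEigen W T γ (prolateDiffOp W T f) where
  ne_zero := h.ne_zero
  continuous := continuous_prolateDiffOp W T h.contDiff
  bandTimeLimit_eq t := by
    rw [← prolateDiffOp_bandTimeLimit W T h.contDiff, funext h.bandTimeLimit_eq]
    simp only [_root_.prolateDiffOp, deriv_const_mul_field, deriv_const_mul_field']
    ring

theorem integral_kernel (h : IsBandTimeEigen W T γ f) (t : ℝ) :
    ∫ s in (-T)..T, samplingKernel W (t - s) * f s = γ * f t :=
  h.bandTimeLimit_eq t

theorem integral_deriv_kernel (h : IsBandTimeEigen W T γ f) (t : ℝ) :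
    ∫ s in (-T)..T, deriv (samplingKernel W) (t - s) * f s = γ * deriv f t := by
  have hleft := hasDerivAt_integral_comp_sub_mul (hasBandSpectrum_samplingKernel W).contDiff
    h.continuous (-T) T t
  refine hleft.unique (((h.hasDerivAt t).const_mul γ).congr_of_eventuallyEq ?_)
  exact .of_forall h.integral_kernel

theorem integral_deriv_deriv_kernel (h : IsBandTimeEigen W T γ f) (t : ℝ) :
    ∫ s in (-T)..T, deriv (deriv (samplingKernel W)) (t - s) * f s = γ * deriv (deriv f) t := by
  have hleft := hasDerivAt_integral_comp_sub_mul (hasBandSpectrum_samplingKernel W).deriv.contDiff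
    h.continuous (-T) T t
  refine hleft.unique (((h.hasDerivAt_deriv t).const_mul γ).congr_of_eventuallyEq ?_)
  exact .of_forall h.integral_deriv_kernel

theorem integral_mul_eq_zero (h : IsBandTimeEigen W T γ f) (h' : IsBandTimeEigen W T γ' g)
    (hne : γ ≠ γ') : ∫ t in (-T)..T, f t * g t = 0 := by
  have hsymm := integral_mul_integral_comp_sub_mul (ε := 1) (continuous_samplingKernel W)
    (by simp [samplingKernel_neg]) h.continuous h'.continuous (-T) T
  simp only [h.integral_kernel, h'.integral_kernel, mul_left_comm _ γ, mul_left_comm _ γ',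
    intervalIntegral.integral_const_mul, one_mul, mul_comm (g _)] at hsymm
  exact (mul_eq_mul_right_iff.1 hsymm).resolve_left hne

theorem integral_mul_deriv (h : IsBandTimeEigen W T γ f) (h' : IsBandTimeEigen W T γ g) :
    ∫ t in (-T)..T, g t * deriv f t = -∫ t in (-T)..T, f t * deriv g t := by
  have hsymm := integral_mul_integral_comp_sub_mul (ε := -1)
    (hasBandSpectrum_samplingKernel W).deriv.continuous (by simp [deriv_samplingKernel_neg])
    h.continuous h'.continuous (-T) T
  simp only [h.integral_deriv_kernel, h'.integral_deriv_kernel, mul_left_comm _ γ,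
    intervalIntegral.integral_const_mul] at hsymm
  refine mul_left_cancel₀ h.ne_zero ?_
  rw [hsymm]
  ring

theorem integral_mul_deriv_deriv (h : IsBandTimeEigen W T γ f) (h' : IsBandTimeEigen W T γ g) :
    ∫ t in (-T)..T, g t * deriv (deriv f) t = ∫ t in (-T)..T, f t * deriv (deriv g) t := by
  have hsymm := integral_mul_integral_comp_sub_mul (ε := 1)
    (hasBandSpectrum_samplingKernel W).deriv.deriv.continuous
    (by simp [deriv_deriv_samplingKernel_neg]) h.continuous h'.continuous (-T) T
  simp only [h.integral_deriv_deriv_kernel, h'.integral_deriv_deriv_kernel, mul_left_comm _ γ,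
    intervalIntegral.integral_const_mul, one_mul] at hsymm
  exact mul_left_cancel₀ h.ne_zero hsymm

theorem boundary_mul (h : IsBandTimeEigen W T γ f) (h' : IsBandTimeEigen W T γ g) :
    f T * g T = f (-T) * g (-T) := by
  have hf := h.continuous
  have hg := h'.continuous
  have hf' := h.continuous_deriv
  have hg' := h'.continuous_deriv
  have hFTC := intervalIntegral.integral_deriv_mul_eq_sub (a := -T) (b := T)
    (fun t _ => h.hasDerivAt t) (fun t _ => h'.hasDerivAt t) (hf'.intervalIntegrable _ _)
    (hg'.intervalIntegrable _ _)
  rw [intervalIntegral.integral_add (Continuous.intervalIntegrable (by fun_prop) _ _)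
    (Continuous.intervalIntegrable (by fun_prop) _ _)] at hFTC
  have hskew := h.integral_mul_deriv h'
  simp only [mul_comm (g _)] at hskew
  linarith

theorem boundary_wronskian (h : IsBandTimeEigen W T γ f) (h' : IsBandTimeEigen W T γ g) :
    deriv f T * g T - f T * deriv g T = deriv f (-T) * g (-T) - f (-T) * deriv g (-T) := by
  have hf := h.continuous
  have hg := h'.continuous
  have hf'' := h.continuous_deriv_deriv
  have hg'' := h'.continuous_deriv_deriv
  have hFTC := intervalIntegral.integral_eq_sub_of_hasDerivAt (a := -T) (b := T)
    (f := fun t => deriv f t * g t - f t * deriv g t)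
    (f' := fun t => g t * deriv (deriv f) t - f t * deriv (deriv g) t)
    (fun t _ => (((h.hasDerivAt_deriv t).mul (h'.hasDerivAt t)).sub
      ((h.hasDerivAt t).mul (h'.hasDerivAt_deriv t))).congr_deriv (by ring))
    (Continuous.intervalIntegrable (by fun_prop) _ _)
  rw [intervalIntegral.integral_sub (Continuous.intervalIntegrable (by fun_prop) _ _)
    (Continuous.intervalIntegrable (by fun_prop) _ _), h.integral_mul_deriv_deriv h',
    sub_self] at hFTC
  linarith

end IsBandTimeEigen

section Simplicity

variable {W T γ : ℝ} {f g : ℝ → ℝ}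

theorem analyticOrderAt_sq_sub_sq (hT : T ≠ 0) :
    analyticOrderAt (fun t : ℝ => T ^ 2 - t ^ 2) T = 1 := by
  have hq : AnalyticAt ℝ (fun t : ℝ => T ^ 2 - t ^ 2) T := by fun_prop
  refine hq.analyticOrderAt_eq_natCast.2
    ⟨fun t => -(T + t), by fun_prop, ?_, .of_forall fun t => ?_⟩
  · simpa [← two_mul] using hT
  · rw [pow_one, smul_eq_mul]
    ring

theorem eventually_prolateDiffOp_eq (W T : ℝ) {z : ℝ} (hf : AnalyticAt ℝ f z) :
    prolateDiffOp W T f =ᶠ[nhds z]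
      deriv ((fun t => T ^ 2 - t ^ 2) * deriv f) +
        (fun _ => W ^ 2) * ((fun t => T ^ 2 - t ^ 2) * f) := by
  filter_upwards [hf.deriv.eventually_analyticAt] with t ht
  have hd := (hasDerivAt_mul_deriv_prolate T ht.differentiableAt).deriv
  simp only [prolateDiffOp, Pi.add_apply, Pi.mul_apply]
  rw [Pi.mul_def, hd]
  ring

theorem analyticOrderAt_prolateDiffOp (W : ℝ) (hT : T ≠ 0) (hf : AnalyticAt ℝ f T) {n : ℕ}
    (hn : analyticOrderAt f T = n + 1) : analyticOrderAt (prolateDiffOp W T f) T = n := by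
  have hq : AnalyticAt ℝ (fun t : ℝ => T ^ 2 - t ^ 2) T := by fun_prop
  have hmain : analyticOrderAt (deriv ((fun t => T ^ 2 - t ^ 2) * deriv f)) T = n := by
    refine analyticOrderAt_deriv_of_pos (hq.mul hf.deriv) ?_
    rw [analyticOrderAt_mul hq hf.deriv, analyticOrderAt_sq_sub_sq hT,
      analyticOrderAt_deriv_of_pos hf hn, add_comm]
  have hpot : (n : ℕ∞) < analyticOrderAt ((fun _ => W ^ 2) * ((fun t => T ^ 2 - t ^ 2) * f)) T := by
    rw [analyticOrderAt_mul analyticAt_const (hq.mul hf), analyticOrderAt_mul hq hf,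
      analyticOrderAt_sq_sub_sq hT, hn]
    refine lt_of_lt_of_le ?_ le_add_self
    exact_mod_cast (by omega : n < 1 + (n + 1))
  rw [analyticOrderAt_congr (eventually_prolateDiffOp_eq W T hf),
    analyticOrderAt_add_eq_left_of_lt (hmain.trans_lt hpot), hmain]

namespace IsBandTimeEigen

theorem eq_zero_of_eventually (h : IsBandTimeEigen W T γ f) {z : ℝ}
    (hz : ∀ᶠ t in nhds z, f t = 0) : f = 0 :=
  AnalyticOnNhd.eq_of_eventuallyEq (fun t _ => h.analyticAt t) (fun _ _ => analyticAt_const) hz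

theorem prolateDiffOp_apply_eq_zero (h : IsBandTimeEigen W T γ f) (h₀ : f T = 0) :
    _root_.prolateDiffOp W T f T = 0 := by
  have h₀' : f (-T) = 0 := by simpa [h₀] using (h.boundary_mul h).symm
  have hright : _root_.prolateDiffOp W T f T = -(2 * T * deriv f T) := by
    simp only [_root_.prolateDiffOp]
    ring
  have hleft : _root_.prolateDiffOp W T f (-T) = 2 * T * deriv f (-T) := by
    simp only [_root_.prolateDiffOp]
    ring
  have hW := h.boundary_wronskian h.prolateDiffOp
  have hsum : T * (deriv f T ^ 2 + deriv f (-T) ^ 2) = 0 := by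
    rw [h₀, h₀', hright, hleft] at hW
    linear_combination -hW / 2
  rw [hright]
  rcases mul_eq_zero.1 hsum with hT | hd
  · simp [hT]
  · have hd₀ : deriv f T = 0 := by nlinarith [sq_nonneg (deriv f T), sq_nonneg (deriv f (-T))]
    simp [hd₀]

theorem analyticOrderAt_ne_natCast (hT : T ≠ 0) (h : IsBandTimeEigen W T γ f) (h₀ : f T = 0)
    (n : ℕ) : analyticOrderAt f T ≠ n := by
  induction n generalizing f with
  | zero => exact (h.analyticAt T).analyticOrderAt_ne_zero.2 h₀
  | succ n ih =>
    intro hn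
    exact ih h.prolateDiffOp (h.prolateDiffOp_apply_eq_zero h₀)
      (analyticOrderAt_prolateDiffOp W hT (h.analyticAt T) (by exact_mod_cast hn))

theorem apply_ne_zero (hT : T ≠ 0) (h : IsBandTimeEigen W T γ f) (hf : f ≠ 0) : f T ≠ 0 := by
  intro h₀
  refine hf (h.eq_zero_of_eventually (z := T) (analyticOrderAt_eq_top.1 ?_))
  by_contra hne
  obtain ⟨n, hn⟩ := ENat.ne_top_iff_exists.1 hne
  exact h.analyticOrderAt_ne_natCast hT h₀ n hn.symm

theorem eq_mul (hT : T ≠ 0) (hf : IsBandTimeEigen W T γ f) (hg : IsBandTimeEigen W T γ g)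
    (hne : f ≠ 0) (t : ℝ) : g t = g T / f T * f t := by
  have hfT := hf.apply_ne_zero hT hne
  by_contra hgt
  refine (hg.sub_const_mul (g T / f T) hf).apply_ne_zero hT (fun h₀ => hgt ?_) (by field_simp; ring)
  exact sub_eq_zero.1 (congrFun h₀ t)

theorem even_sq (hT : T ≠ 0) (h : IsBandTimeEigen W T γ f) : Function.Even fun t => f t ^ 2 := by
  intro t
  rcases eq_or_ne f 0 with rfl | hf
  · simp
  have hfT := h.apply_ne_zero hT hf
  have hend : (f (-T) / f T) ^ 2 = 1 := by
    rw [div_pow, div_eq_one_iff_eq (pow_ne_zero 2 hfT)]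
    linear_combination -h.boundary_mul h
  dsimp only
  rw [h.eq_mul hT h.comp_neg hf t, mul_pow, hend, one_mul]

theorem odd_mul_deriv (hT : T ≠ 0) (h : IsBandTimeEigen W T γ f) :
    Function.Odd fun t => f t * deriv f t := by
  intro t
  have hd (t : ℝ) : deriv (fun t => f t ^ 2) t = 2 * (f t * deriv f t) := by
    rw [((h.hasDerivAt t).fun_pow 2).deriv]
    ring
  have hodd := deriv_comp_neg (fun t => f t ^ 2) t
  simp only [h.even_sq hT _, hd] at hodd
  change f (-t) * deriv f (-t) = -(f t * deriv f t)
  linarith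

theorem existsUnique_solvesPSWEq (hT : T ≠ 0) (h : IsBandTimeEigen W T γ f) (hf : f ≠ 0) :
    ∃! lam, SolvesPSWEq W T lam f := by
  refine ⟨-(_root_.prolateDiffOp W T f T / f T), fun t => ?_, fun lam hlam => ?_⟩
  · rw [neg_neg]
    exact h.eq_mul hT h.prolateDiffOp hf t
  · rw [hlam T, mul_div_cancel_right₀ _ (h.apply_ne_zero hT hf), neg_neg]

end IsBandTimeEigen

end Simplicity

section Energy

variable {W T γ lam : ℝ} {a b : ℝ → ℂ} {f g u : ℝ → ℝ}

theorem energyInside_nonneg (hT : 0 ≤ T) (f : ℝ → ℝ) : 0 ≤ energyInside T f :=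
  intervalIntegral.integral_nonneg (by linarith) fun _ _ => sq_nonneg _

theorem energyOutside_nonneg (T : ℝ) (f : ℝ → ℝ) : 0 ≤ energyOutside T f :=
  integral_nonneg fun _ => sq_nonneg _

theorem isOpen_lt_abs (T : ℝ) : IsOpen {t : ℝ | T < |t|} :=
  isOpen_lt continuous_const continuous_abs

theorem energyInside_add_energyOutside (hT : 0 ≤ T) (hf : MemLp f 2) :
    energyInside T f + energyOutside T f = ∫ t, f t ^ 2 := by
  rw [energyInside, energyOutside, intervalIntegral.integral_of_le (by linarith),
    ← integral_Icc_eq_integral_Ioc, ← integral_add_compl measurableSet_Icc hf.integrable_sq]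
  congr 3
  ext t
  simp [abs_le, ← not_le]

theorem energyOutside_pos (hf : Continuous f) (hf₂ : MemLp f 2) {t : ℝ} (ht : T < |t|)
    (hft : f t ≠ 0) : 0 < energyOutside T f := by
  rw [energyOutside, setIntegral_pos_iff_support_of_nonneg_ae (.of_forall fun _ => sq_nonneg _)
    hf₂.integrable_sq.integrableOn]
  refine ((hf.pow 2).isOpen_support.inter (isOpen_lt_abs T)).measure_pos volume ⟨t, ?_, ht⟩
  exact pow_ne_zero 2 hft

theorem lineNorm_sq (f : ℝ → ℝ) : lineNorm f ^ 2 = ∫ t, f t ^ 2 :=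
  Real.sq_sqrt (integral_nonneg fun _ => sq_nonneg _)

namespace HasBandSpectrum

theorem add (hg : HasBandSpectrum W a g) (hu : HasBandSpectrum W b u) :
    HasBandSpectrum W (fun w => a w + b w) fun t => g t + u t where
  continuous_spectrum := hg.continuous_spectrum.add hu.continuous_spectrum
  eq_bandSynthesis t := by
    have ha := hg.continuous_spectrum
    have hb := hu.continuous_spectrum
    rw [Complex.ofReal_add, hg.eq_bandSynthesis, hu.eq_bandSynthesis, bandSynthesis, bandSynthesis,
      ← intervalIntegral.integral_add (Continuous.intervalIntegrable (by fun_prop) _ _)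
        (Continuous.intervalIntegrable (by fun_prop) _ _)]
    simp only [bandSynthesis, add_mul]

theorem integral_mul (hW : 0 ≤ W) (hg : HasBandSpectrum W a g) (hu : HasBandSpectrum W b u) :
    ∫ t, g t * u t = 2 * Real.pi * ∫ w in (-W)..W, (a w * (starRingEnd ℂ) (b w)).re := by
  have ha := hg.continuous_spectrum
  have hb := hu.continuous_spectrum
  have hg₂ := hg.memLp_two hW
  have hu₂ := hu.memLp_two hW
  have hsignal : ∫ t, (g t + u t) ^ 2 =
      ((∫ t, g t ^ 2) + ∫ t, u t ^ 2) + 2 * ∫ t, g t * u t := by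
    rw [← integral_const_mul, ← integral_add hg₂.integrable_sq hu₂.integrable_sq,
      ← integral_add (by exact hg₂.integrable_sq.add hu₂.integrable_sq)
        (by exact (hg₂.integrable_mul hu₂).const_mul 2)]
    congr 1 with t
    ring
  have : Continuous fun w => (a w * (starRingEnd ℂ) (b w)).re :=
    Complex.continuous_re.comp (ha.mul (Complex.continuous_conj.comp hb))
  have hspectrum : ∫ w in (-W)..W, ‖a w + b w‖ ^ 2 =
      ((∫ w in (-W)..W, ‖a w‖ ^ 2) + ∫ w in (-W)..W, ‖b w‖ ^ 2) +
        2 * ∫ w in (-W)..W, (a w * (starRingEnd ℂ) (b w)).re := by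
    rw [← intervalIntegral.integral_const_mul,
      ← intervalIntegral.integral_add (Continuous.intervalIntegrable (by fun_prop) _ _)
        (Continuous.intervalIntegrable (by fun_prop) _ _),
      ← intervalIntegral.integral_add (Continuous.intervalIntegrable (by fun_prop) _ _)
        (Continuous.intervalIntegrable (by fun_prop) _ _)]
    simp only [← Complex.normSq_eq_norm_sq, Complex.normSq_add]
  have hparseval := (hg.add hu).integral_sq hW
  rw [hsignal, hspectrum, hg.integral_sq hW, hu.integral_sq hW] at hparseval
  linear_combination hparseval / 2

/-- The band limiting operator is self-adjoint and fixes `u`. -/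
theorem integral_bandTimeLimit_mul (hW : 0 ≤ W) (hu : HasBandSpectrum W b u) (T : ℝ)
    (hf : Continuous f) :
    ∫ t, bandTimeLimit W T f t * u t = ∫ t in (-T)..T, f t * u t := by
  have hb := hu.continuous_spectrum
  have hτ := continuous_timeSpectrum T hf
  have hpair : ((∫ t in (-T)..T, f t * u t : ℝ) : ℂ) =
      (2 * Real.pi : ℝ) * ∫ w in (-W)..W, b w * (starRingEnd ℂ) (timeSpectrum T f w) := by
    rw [Complex.ofReal_mul, Complex.ofReal_ofNat, ← integral_mul_bandSynthesis W T hf hb,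
      ← intervalIntegral.integral_ofReal]
    simp only [Complex.ofReal_mul, hu.eq_bandSynthesis]
  have hre := Complex.reCLM.intervalIntegral_comp_comm (a := -W) (b := W) (μ := volume)
    (f := fun w => b w * (starRingEnd ℂ) (timeSpectrum T f w))
    (Continuous.intervalIntegrable (by fun_prop) _ _)
  simp only [Complex.reCLM_apply] at hre
  simp only [mul_comm _ (u _)]
  rw [hu.integral_mul hW (hasBandSpectrum_bandTimeLimit W T hf), hre, ← Complex.re_ofReal_mul,
    ← hpair, Complex.ofReal_re]
  simp only [mul_comm (u _)]

end HasBandSpectrum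

namespace IsBandTimeEigen

theorem integral_mul_eq (hW : 0 ≤ W) (h : IsBandTimeEigen W T γ f) (hu : HasBandSpectrum W b u) :
    ∫ t in (-T)..T, f t * u t = γ * ∫ t, f t * u t := by
  rw [← hu.integral_bandTimeLimit_mul hW T h.continuous]
  simp only [h.bandTimeLimit_eq, mul_assoc, integral_const_mul]

theorem energyInside_eq (hW : 0 ≤ W) (h : IsBandTimeEigen W T γ f) :
    energyInside T f = γ * ∫ t, f t ^ 2 := by
  simp only [energyInside, pow_two]
  exact h.integral_mul_eq hW h.hasBandSpectrum

theorem integral_mul_deriv_deriv_self (hW : 0 ≤ W) (h : IsBandTimeEigen W T γ f) :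
    ∫ t in (-T)..T, f t * deriv (deriv f) t = -(γ * ∫ t, deriv f t ^ 2) := by
  have hf := h.memLp_two hW
  have hf' := h.memLp_two_deriv hW
  have hf'' := h.hasBandSpectrum.deriv.deriv.memLp_two hW
  rw [h.integral_mul_eq hW h.hasBandSpectrum.deriv.deriv,
    integral_mul_deriv_eq_deriv_mul_of_integrable (fun t _ => h.hasDerivAt t)
      (fun t _ => h.hasDerivAt_deriv t) (hf.integrable_mul hf'') (hf'.integrable_mul hf')
      (hf.integrable_mul hf'), mul_neg]
  simp only [pow_two]

theorem integral_sq_pos (hW : 0 ≤ W) (h : IsBandTimeEigen W T γ f) (hf : f ≠ 0) :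
    0 < ∫ t, f t ^ 2 := by
  obtain ⟨x, hx⟩ := Function.ne_iff.1 hf
  exact integral_pos_of_integrable_nonneg_nonzero (h.continuous.pow 2)
    (h.memLp_two hW).integrable_sq (fun _ => sq_nonneg _) (pow_ne_zero 2 hx)

theorem eigenvalue_pos (hW : 0 ≤ W) (hT : 0 ≤ T) (h : IsBandTimeEigen W T γ f) (hf : f ≠ 0) :
    0 < γ := by
  have hnonneg := energyInside_nonneg hT f
  rw [h.energyInside_eq hW] at hnonneg
  exact (nonneg_of_mul_nonneg_left hnonneg (h.integral_sq_pos hW hf)).lt_of_ne' h.ne_zero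

theorem energyInside_pos (hW : 0 ≤ W) (hT : 0 ≤ T) (h : IsBandTimeEigen W T γ f) (hf : f ≠ 0) :
    0 < energyInside T f := by
  rw [h.energyInside_eq hW]
  exact mul_pos (h.eigenvalue_pos hW hT hf) (h.integral_sq_pos hW hf)

theorem eigenvalue_lt_one (hW : 0 ≤ W) (hT : 0 ≤ T) (h : IsBandTimeEigen W T γ f) (hf : f ≠ 0) :
    γ < 1 := by
  obtain ⟨t, ht, hft⟩ : ∃ t, T < |t| ∧ f t ≠ 0 := by
    by_contra! hzero
    refine hf (h.eq_zero_of_eventually (z := T + 1) ?_)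
    filter_upwards [(isOpen_lt_abs T).mem_nhds ((lt_add_one T).trans_le (le_abs_self _))]
      using hzero
  have hout := energyOutside_pos h.continuous (h.memLp_two hW) ht hft
  have hsum := energyInside_add_energyOutside hT (h.memLp_two hW)
  rw [h.energyInside_eq hW] at hsum
  nlinarith [h.integral_sq_pos hW hf]

end IsBandTimeEigen

theorem SolvesPSWEq.deriv_apply (hT : T ≠ 0) (hl : SolvesPSWEq W T lam f) :
    deriv f T = lam * f T / (2 * T) := by
  have hsing := hl T
  rw [prolateDiffOp] at hsing
  field_simp
  linarith

theorem SolvesPSWEq.integral_weight_mul (hf : ContDiff ℝ 2 f) (hl : SolvesPSWEq W T lam f) :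
    ∫ t in (-T)..T, (W ^ 2 * (T ^ 2 - t ^ 2) + lam) * f t = 0 := by
  have hf₀ := hf.continuous
  have hgreen := integral_prolateDiffOp_mul W T hf (v := fun _ => 1) contDiff_const
  simp only [hl _, mul_one, deriv_const, mul_zero, sub_zero] at hgreen
  rw [← sub_eq_zero, ← intervalIntegral.integral_sub
    (Continuous.intervalIntegrable (by fun_prop) _ _)
    (Continuous.intervalIntegrable (by fun_prop) _ _)] at hgreen
  rw [← neg_eq_zero, ← intervalIntegral.integral_neg, ← hgreen]
  congr 1 with t
  ring

theorem SolvesPSWEq.neg_le (hT : 0 ≤ T) (hf : ContDiff ℝ 2 f) (hl : SolvesPSWEq W T lam f)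
    (hpos : 0 < energyInside T f) : -lam ≤ W ^ 2 * T ^ 2 := by
  have hf₀ := hf.continuous
  have hf₁ := hf.continuous_deriv one_le_two
  have hgreen := integral_prolateDiffOp_mul W T hf (hf.of_le one_le_two)
  simp only [hl _] at hgreen
  have hmono : ∫ t in (-T)..T, (W ^ 2 * (T ^ 2 - t ^ 2) * (f t * f t) -
      (T ^ 2 - t ^ 2) * (deriv f t * deriv f t)) ≤ ∫ t in (-T)..T, W ^ 2 * T ^ 2 * f t ^ 2 := by
    refine intervalIntegral.integral_mono_on (by linarith)
      (Continuous.intervalIntegrable (by fun_prop) _ _)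
      (Continuous.intervalIntegrable (by fun_prop) _ _) fun t ht => ?_
    have hkinetic : 0 ≤ (T ^ 2 - t ^ 2) * deriv f t ^ 2 :=
      mul_nonneg (sub_nonneg.2 (sq_le_sq' ht.1 ht.2)) (sq_nonneg _)
    have hpot : 0 ≤ W ^ 2 * t ^ 2 * f t ^ 2 := by positivity
    linarith
  rw [← hgreen] at hmono
  simp only [mul_assoc, ← pow_two, intervalIntegral.integral_const_mul] at hmono
  rw [← energyInside, ← mul_assoc] at hmono
  exact le_of_mul_le_mul_right hmono hpos

theorem IsBandTimeEigen.energyInside_deriv_eq (hW : 0 ≤ W) (hT : T ≠ 0)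
    (h : IsBandTimeEigen W T γ f) (hl : SolvesPSWEq W T lam f) :
    energyInside T (deriv f) = γ * (∫ t, deriv f t ^ 2) + lam / T * f T ^ 2 := by
  have hf := h.continuous
  have hf' := h.continuous_deriv
  have hf'' := h.continuous_deriv_deriv
  have hends : f (-T) * deriv f (-T) = -(f T * deriv f T) := h.odd_mul_deriv hT T
  have hFTC := intervalIntegral.integral_deriv_mul_eq_sub (a := -T) (b := T)
    (fun t _ => h.hasDerivAt t) (fun t _ => h.hasDerivAt_deriv t) (hf'.intervalIntegrable _ _)
    (hf''.intervalIntegrable _ _)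
  rw [intervalIntegral.integral_add (Continuous.intervalIntegrable (by fun_prop) _ _)
    (Continuous.intervalIntegrable (by fun_prop) _ _), h.integral_mul_deriv_deriv_self hW, hends,
    hl.deriv_apply hT] at hFTC
  have henergy : energyInside T (deriv f) = ∫ t in (-T)..T, deriv f t * deriv f t := by
    simp only [energyInside, pow_two]
  linear_combination henergy + hFTC

end Energy

section SupBounds

variable {T : ℝ} {f : ℝ → ℝ}

theorem integral_abs_mul_le_sqrt_mul_sqrt {α : Type*} [MeasurableSpace α] {μ : Measure α}
    {f g : α → ℝ} (hf : MemLp f 2 μ) (hg : MemLp g 2 μ) :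
    ∫ x, |f x * g x| ∂μ ≤ √(∫ x, f x ^ 2 ∂μ) * √(∫ x, g x ^ 2 ∂μ) := by
  have hHolder := integral_mul_norm_le_Lp_mul_Lq (p := 2) (q := 2) (μ := μ) (f := f) (g := g)
    Real.HolderConjugate.two_two (by simpa using hf) (by simpa using hg)
  simpa [Real.sqrt_eq_rpow, abs_mul] using hHolder

theorem hasDerivAt_sq {t : ℝ} (hf : DifferentiableAt ℝ f t) :
    HasDerivAt (fun t => f t ^ 2) (2 * (f t * deriv f t)) t :=
  (hf.hasDerivAt.fun_pow 2).congr_deriv (by simp [mul_assoc])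

theorem sq_sub_sq_le_two_mul_integral_abs (hf : ContDiff ℝ 1 f) {a b z t : ℝ}
    (hz : z ∈ Set.Icc a b) (ht : t ∈ Set.Icc a b) :
    f t ^ 2 - f z ^ 2 ≤ 2 * ∫ x in a..b, |f x * deriv f x| := by
  have hf₀ := hf.continuous
  have := hf.continuous_deriv le_rfl
  have hab : a ≤ b := hz.1.trans hz.2
  have hsub : Set.uIoc z t ⊆ Set.uIoc a b := by
    rw [Set.uIoc_of_le hab]
    exact fun x hx => ⟨(le_min hz.1 ht.1).trans_lt hx.1, hx.2.trans (max_le hz.2 ht.2)⟩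
  rw [← intervalIntegral.integral_eq_sub_of_hasDerivAt
    (fun x _ => hasDerivAt_sq (hf.differentiable one_ne_zero x))
    (Continuous.intervalIntegrable (by fun_prop) _ _), intervalIntegral.integral_const_mul]
  refine mul_le_mul_of_nonneg_left ?_ zero_le_two
  refine (le_abs_self _).trans ?_
  refine (intervalIntegral.norm_integral_le_abs_integral_norm (f := fun x => f x * deriv f x)).trans
    ?_
  refine (intervalIntegral.abs_integral_mono_interval hsub (.of_forall fun _ => abs_nonneg _)
    (Continuous.intervalIntegrable (by fun_prop) _ _)).trans_eq ?_
  exact abs_of_nonneg (intervalIntegral.integral_nonneg hab fun _ _ => abs_nonneg _)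

theorem sq_le_two_mul_integral_abs_Ioi (hf : ContDiff ℝ 1 f) (hf₂ : MemLp f 2)
    (hf'₂ : MemLp (deriv f) 2) (t : ℝ) :
    f t ^ 2 ≤ 2 * ∫ x in Set.Ioi t, |f x * deriv f x| := by
  have hderiv x (_ : x ∈ Set.Ioi t) := hasDerivAt_sq (hf.differentiable one_ne_zero x)
  have h_int : IntegrableOn (fun x => 2 * (f x * deriv f x)) (Set.Ioi t) :=
    ((hf₂.integrable_mul hf'₂).const_mul 2).integrableOn
  have hlim := tendsto_zero_of_hasDerivAt_of_integrableOn_Ioi hderiv h_int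
    hf₂.integrable_sq.integrableOn
  have hFTC := integral_Ioi_of_hasDerivAt_of_tendsto (f := fun x => f x ^ 2)
    (hf.continuous.fun_pow 2).continuousWithinAt hderiv h_int hlim
  rw [integral_const_mul] at hFTC
  have habs := abs_integral_le_integral_abs (μ := volume.restrict (Set.Ioi t))
    (f := fun x => f x * deriv f x)
  linarith [(abs_le.1 habs).1]

theorem sq_le_two_mul_integral_abs_Iic (hf : ContDiff ℝ 1 f) (hf₂ : MemLp f 2)
    (hf'₂ : MemLp (deriv f) 2) (t : ℝ) :
    f t ^ 2 ≤ 2 * ∫ x in Set.Iic t, |f x * deriv f x| := by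
  have hderiv x (_ : x ∈ Set.Iic t) := hasDerivAt_sq (hf.differentiable one_ne_zero x)
  have h_int : IntegrableOn (fun x => 2 * (f x * deriv f x)) (Set.Iic t) :=
    ((hf₂.integrable_mul hf'₂).const_mul 2).integrableOn
  have hlim := tendsto_zero_of_hasDerivAt_of_integrableOn_Iic hderiv h_int
    hf₂.integrable_sq.integrableOn
  have hFTC := integral_Iic_of_hasDerivAt_of_tendsto (f := fun x => f x ^ 2)
    (hf.continuous.fun_pow 2).continuousWithinAt
    (fun x hx => hderiv x (Set.Iio_subset_Iic_self hx)) h_int hlim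
  rw [integral_const_mul] at hFTC
  have habs := abs_integral_le_integral_abs (μ := volume.restrict (Set.Iic t))
    (f := fun x => f x * deriv f x)
  linarith [(abs_le.1 habs).2]

theorem sq_abs_of_even_sq (hf : Function.Even fun t => f t ^ 2) (t : ℝ) : f |t| ^ 2 = f t ^ 2 := by
  rcases abs_choice t with h | h <;> rw [h]
  exact hf t

theorem sq_le_sqrt_energyOutside_mul (hf : ContDiff ℝ 1 f) (heven : Function.Even fun t => f t ^ 2)
    (hf₂ : MemLp f 2) (hf'₂ : MemLp (deriv f) 2) {t : ℝ} (ht : T ≤ |t|) :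
    f t ^ 2 ≤ √(energyOutside T f) * √(energyOutside T (deriv f)) := by
  have h_int : Integrable fun x => |f x * deriv f x| := (hf₂.integrable_mul hf'₂).abs
  have hunion : {x : ℝ | |t| < |x|} = Set.Iio (-|t|) ∪ Set.Ioi |t| := by
    ext x
    simp [lt_abs (b := x), or_comm, lt_neg]
  have hdisj : Disjoint (Set.Iio (-|t|)) (Set.Ioi |t|) :=
    (Set.Iio_disjoint_Ici ((neg_abs_le t).trans (le_abs_self t))).mono_right Set.Ioi_subset_Ici_self
  have hsplit : ∫ x in {x : ℝ | |t| < |x|}, |f x * deriv f x| =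
      (∫ x in Set.Iic (-|t|), |f x * deriv f x|) + ∫ x in Set.Ioi |t|, |f x * deriv f x| := by
    rw [hunion, setIntegral_union hdisj measurableSet_Ioi h_int.integrableOn h_int.integrableOn,
      integral_Iic_eq_integral_Iio]
  have hmono : ∫ x in {x : ℝ | |t| < |x|}, |f x * deriv f x| ≤
      ∫ x in {x : ℝ | T < |x|}, |f x * deriv f x| :=
    setIntegral_mono_set h_int.integrableOn (.of_forall fun _ => abs_nonneg _)
      (LE.le.eventuallyLE fun _ hx => ht.trans_lt hx)
  refine le_trans ?_ (hmono.trans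
    (integral_abs_mul_le_sqrt_mul_sqrt (hf₂.restrict _) (hf'₂.restrict _)))
  have hneg : f (-|t|) ^ 2 = f |t| ^ 2 := heven |t|
  rw [hsplit, ← sq_abs_of_even_sq heven]
  linarith [sq_le_two_mul_integral_abs_Iic hf hf₂ hf'₂ (-|t|),
    sq_le_two_mul_integral_abs_Ioi hf hf₂ hf'₂ |t|]

theorem memLp_two_restrict_Ioc (hf : Continuous f) (a b : ℝ) :
    MemLp f 2 (volume.restrict (Set.Ioc a b)) :=
  (memLp_two_iff_integrable_sq hf.aestronglyMeasurable).2 (hf.pow 2).integrableOn_Ioc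

theorem sq_sub_sq_le_sqrt_energyInside_mul (hf : ContDiff ℝ 1 f)
    (heven : Function.Even fun t => f t ^ 2) {z t : ℝ} (hz : |z| ≤ T) (ht : |t| ≤ T) :
    f t ^ 2 - f z ^ 2 ≤ √(energyInside T f) * √(energyInside T (deriv f)) := by
  have hf₀ := hf.continuous
  have hf₁ := hf.continuous_deriv le_rfl
  have hT : 0 ≤ T := (abs_nonneg t).trans ht
  have hcauchy := integral_abs_mul_le_sqrt_mul_sqrt (memLp_two_restrict_Ioc hf₀ (-T) T)
    (memLp_two_restrict_Ioc hf₁ (-T) T)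
  simp only [← intervalIntegral.integral_of_le (neg_le_self hT)] at hcauchy
  refine le_trans ?_ hcauchy
  rw [← sq_abs_of_even_sq heven, ← sq_abs_of_even_sq heven z,
    ← intervalIntegral.integral_add_adjacent_intervals (b := 0)
      (Continuous.intervalIntegrable (by fun_prop) _ _)
      (Continuous.intervalIntegrable (by fun_prop) _ _)]
  have hnegt : f (-|t|) ^ 2 = f |t| ^ 2 := heven |t|
  have hnegz : f (-|z|) ^ 2 = f |z| ^ 2 := heven |z|
  have hright := sq_sub_sq_le_two_mul_integral_abs hf (a := 0) (b := T)
    ⟨abs_nonneg z, hz⟩ ⟨abs_nonneg t, ht⟩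
  have hleft := sq_sub_sq_le_two_mul_integral_abs hf (a := -T) (b := 0)
    ⟨neg_le_neg hz, neg_nonpos.2 (abs_nonneg z)⟩ ⟨neg_le_neg ht, neg_nonpos.2 (abs_nonneg t)⟩
  linarith

end SupBounds

section PairingOperator

variable {X H : Type*} [TopologicalSpace X] [CompactSpace X] [NormedAddCommGroup H]
  [InnerProductSpace ℝ H]

/-- The operator `f ↦ (t ↦ ⟪a t, f⟫)` given by a continuous curve `a` in a Hilbert space; integral
operators with a continuous kernel are of this form. -/
noncomputable def pairingOp (a : C(X, H)) : H →L[ℝ] C(X, ℝ) :=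
  LinearMap.mkContinuous
    { toFun := fun f => ⟨fun t => inner ℝ (a t) f, by fun_prop⟩
      map_add' := fun f g => by ext t; simp [inner_add_right]
      map_smul' := fun c f => by ext t; simp [inner_smul_right] } ‖a‖ (fun f => by
    refine (ContinuousMap.norm_le _ (by positivity)).2 fun t => ?_
    exact (norm_inner_le_norm _ _).trans
      (mul_le_mul_of_nonneg_right (a.norm_coe_le_norm t) (norm_nonneg f)))

theorem pairingOp_apply (a : C(X, H)) (f : H) (t : X) : pairingOp a f t = inner ℝ (a t) f := rfl

theorem isCompactOperator_pairingOp (a : C(X, H)) : IsCompactOperator (pairingOp a) := by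
  let e := ContinuousMap.linearIsometryBoundedOfCompact X ℝ ℝ
  have hc : IsCompactOperator fun f => e (pairingOp a f) := by
    rw [isCompactOperator_iff_exists_mem_nhds_isCompact_closure_image]
    refine ⟨Metric.closedBall 0 1, Metric.closedBall_mem_nhds 0 one_pos, ?_⟩
    refine BoundedContinuousFunction.arzela_ascoli (Metric.closedBall 0 ‖a‖)
      (isCompact_closedBall _ _) _ ?_ ?_
    · rintro _ t ⟨f, hf, rfl⟩
      rw [mem_closedBall_zero_iff] at hf ⊢
      exact ((norm_inner_le_norm (a t) f).trans (mul_le_mul (a.norm_coe_le_norm t) hf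
        (norm_nonneg _) (norm_nonneg _))).trans_eq (mul_one _)
    · refine fun t => Metric.equicontinuousAt_of_continuity_modulus (fun s => dist (a t) (a s)) ?_ _
        (Filter.Eventually.of_forall ?_)
      · exact Continuous.tendsto' (by fun_prop) _ _ (dist_self _)
      · rintro s ⟨_, f, hf, rfl⟩
        rw [mem_closedBall_zero_iff] at hf
        change ‖inner ℝ (a t) f - inner ℝ (a s) f‖ ≤ _
        rw [← inner_sub_left, dist_eq_norm]
        exact (norm_inner_le_norm _ _).trans (mul_le_of_le_one_right (norm_nonneg _) hf)
  simpa [Function.comp_def] using hc.continuous_comp e.symm.continuous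

end PairingOperator

section SymmetricKernel

variable {X : Type*} [TopologicalSpace X] [CompactSpace X] [MeasurableSpace X] [BorelSpace X]
  (μ : Measure X) [IsFiniteMeasure μ] (k : C(X × X, ℝ))

/-- The integral operator `f ↦ ∫ k(·, s) f(s) dμ(s)` with continuous kernel `k`, from `L²(μ)` to
the continuous functions on a compact space. -/
noncomputable def kernelPairing : Lp ℝ 2 μ →L[ℝ] C(X, ℝ) :=
  pairingOp ⟨fun t => ContinuousMap.toLp 2 μ ℝ (k.curry t), by fun_prop⟩

theorem kernelPairing_apply (f : Lp ℝ 2 μ) (t : X) :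
    kernelPairing μ k f t = ∫ s, k (t, s) * f s ∂μ := by
  rw [kernelPairing, pairingOp_apply, L2.inner_def]
  refine integral_congr_ae ?_
  filter_upwards [ContinuousMap.coeFn_toLp (p := 2) (𝕜 := ℝ) μ (k.curry t)] with s hs
  rw [ContinuousMap.coe_mk, hs]
  simp [mul_comm]

theorem kernelPairing_toLp (φ : C(X, ℝ)) (t : X) :
    kernelPairing μ k (ContinuousMap.toLp 2 μ ℝ φ) t = ∫ s, k (t, s) * φ s ∂μ := by
  rw [kernelPairing, pairingOp_apply]
  exact (ContinuousMap.inner_toLp μ _ _).trans (by simp [mul_comm])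

/-- The integral operator with continuous kernel `k`, as an operator on `L²(μ)`. -/
noncomputable def kernelOp : Lp ℝ 2 μ →L[ℝ] Lp ℝ 2 μ :=
  (ContinuousMap.toLp 2 μ ℝ).comp (kernelPairing μ k)

theorem isCompactOperator_kernelOp : IsCompactOperator (kernelOp μ k) :=
  (isCompactOperator_pairingOp _).clm_comp (ContinuousMap.toLp 2 μ ℝ)

theorem inner_kernelOp (f g : Lp ℝ 2 μ) :
    inner ℝ (kernelOp μ k f) g = ∫ t, (∫ s, k (t, s) * f s ∂μ) * g t ∂μ := by
  rw [L2.inner_def]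
  refine integral_congr_ae ?_
  filter_upwards [ContinuousMap.coeFn_toLp (p := 2) (𝕜 := ℝ) μ (kernelPairing μ k f)] with t ht
  rw [kernelOp, ContinuousLinearMap.comp_apply, ht, kernelPairing_apply]
  simp [mul_comm]

variable {μ k}

theorem isSelfAdjoint_kernelOp [SecondCountableTopology X] (hk : ∀ s t, k (s, t) = k (t, s)) :
    IsSelfAdjoint (kernelOp μ k) := by
  rw [ContinuousLinearMap.isSelfAdjoint_iff_isSymmetric]
  intro f g
  have h_int : Integrable (fun z : X × X => k z * (g z.1 * f z.2)) (μ.prod μ) :=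
    (((Lp.memLp g).integrable one_le_two).mul_prod ((Lp.memLp f).integrable one_le_two)).bdd_mul
      k.continuous.aestronglyMeasurable (Filter.Eventually.of_forall k.norm_coe_le_norm)
  calc inner ℝ (kernelOp μ k f) g = ∫ t, ∫ s, k (t, s) * (g t * f s) ∂μ ∂μ := by
        simp only [inner_kernelOp, ← integral_mul_const, mul_assoc, mul_comm (g _)]
    _ = ∫ s, ∫ t, k (t, s) * (g t * f s) ∂μ ∂μ := integral_integral_swap h_int
    _ = inner ℝ (kernelOp μ k g) f := by
        simp only [inner_kernelOp, ← integral_mul_const, mul_assoc, hk]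
    _ = inner ℝ f (kernelOp μ k g) := real_inner_comm _ _

theorem exists_abs_eq_norm_kernelOp [SecondCountableTopology X] (hk : ∀ s t, k (s, t) = k (t, s))
    (h0 : kernelOp μ k ≠ 0) :
    ∃ (m : ℝ) (f : Lp ℝ 2 μ), |m| = ‖kernelOp μ k‖ ∧ f ≠ 0 ∧ kernelOp μ k f = m • f := by
  have hrad := (kernelOp μ k).spectralRadius_eq_nnnorm (isSelfAdjoint_kernelOp hk)
  have hne : (spectrum ℝ (kernelOp μ k)).Nonempty := by
    by_contra! hempty
    have hnorm : ‖kernelOp μ k‖₊ = 0 := by simpa [spectralRadius, hempty] using hrad.symm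
    exact h0 (nnnorm_eq_zero.1 hnorm)
  obtain ⟨m, hm, hnorm⟩ := spectrum.exists_nnnorm_eq_spectralRadius_of_nonempty hne
  have hmK : |m| = ‖kernelOp μ k‖ :=
    congrArg NNReal.toReal (ENNReal.coe_injective (hnorm.trans hrad))
  have hm0 : m ≠ 0 := abs_ne_zero.1 (hmK ▸ norm_ne_zero_iff.2 h0)
  obtain ⟨f, hf⟩ := (((isCompactOperator_kernelOp μ k).hasEigenvalue_iff_mem_spectrum hm0).2
    hm).exists_hasEigenvector
  exact ⟨m, f, hmK, hf.2, hf.apply_eq_smul⟩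

theorem exists_eigenfunction_forall_abs_integral_le [SecondCountableTopology X]
    (hk : ∀ s t, k (s, t) = k (t, s)) {φ₀ : C(X, ℝ)}
    (h0 : ∫ t, (∫ s, k (t, s) * φ₀ s ∂μ) * φ₀ t ∂μ ≠ 0) :
    ∃ (m : ℝ) (u : C(X, ℝ)), m ≠ 0 ∧ u ≠ 0 ∧ (∀ t, ∫ s, k (t, s) * u s ∂μ = m * u t) ∧
      ∀ φ : C(X, ℝ), |∫ t, (∫ s, k (t, s) * φ s ∂μ) * φ t ∂μ| ≤ |m| * ∫ t, φ t ^ 2 ∂μ := by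
  have hinner (φ : C(X, ℝ)) : inner ℝ (kernelOp μ k (ContinuousMap.toLp 2 μ ℝ φ))
      (ContinuousMap.toLp 2 μ ℝ φ) = ∫ t, (∫ s, k (t, s) * φ s ∂μ) * φ t ∂μ :=
    (ContinuousMap.inner_toLp μ _ _).trans (by simp [kernelPairing_toLp, mul_comm])
  have hK : kernelOp μ k ≠ 0 := fun hK => h0 (by rw [← hinner, hK]; simp)
  obtain ⟨m, f, hm, hf, hfm⟩ := exists_abs_eq_norm_kernelOp hk hK
  have hm0 : m ≠ 0 := abs_ne_zero.1 (hm ▸ norm_ne_zero_iff.2 hK)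
  let u := m⁻¹ • kernelPairing μ k f
  have hu : ContinuousMap.toLp 2 μ ℝ u = f := by
    rw [map_smul]
    exact (congrArg (m⁻¹ • ·) hfm).trans (inv_smul_smul₀ hm0 f)
  refine ⟨m, u, hm0, fun h => hf (by rw [← hu, h, map_zero]), fun t => ?_, fun φ => ?_⟩
  · rw [← kernelPairing_toLp, hu]
    exact (mul_inv_cancel_left₀ hm0 _).symm
  · have hnorm : ‖ContinuousMap.toLp 2 μ ℝ φ‖ ^ 2 = ∫ t, φ t ^ 2 ∂μ := by
      rw [← real_inner_self_eq_norm_sq]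
      exact (ContinuousMap.inner_toLp μ _ _).trans (by simp [pow_two])
    rw [← hinner, hm, ← hnorm, pow_two, ← mul_assoc]
    exact (abs_real_inner_le_norm _ _).trans
      (mul_le_mul_of_nonneg_right ((kernelOp μ k).le_opNorm _) (norm_nonneg _))

end SymmetricKernel

section TopEigenvalue

attribute [local instance] Measure.Subtype.measureSpace

variable {W T γ : ℝ} {f g : ℝ → ℝ} {a : ℝ → ℂ}

theorem integral_Icc_subtype (hT : 0 ≤ T) (f : ℝ → ℝ) :
    ∫ t : Set.Icc (-T) T, f t = ∫ t in (-T)..T, f t := by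
  rw [integral_subtype measurableSet_Icc f, integral_Icc_eq_integral_Ioc,
    intervalIntegral.integral_of_le (by linarith)]

/-- A continuous eigenfunction on `[-T, T]` extends to the line, because `B_W D_T f` is defined on
the whole line and depends only on the values of `f` on `[-T, T]`. -/
theorem exists_isBandTimeEigen_eqOn (hT : 0 ≤ T) (hγ : γ ≠ 0) (hf : Continuous f)
    (h : ∀ t ∈ Set.Icc (-T) T, bandTimeLimit W T f t = γ * f t) :
    ∃ p, IsBandTimeEigen W T γ p ∧ Set.EqOn p f (Set.Icc (-T) T) := by
  have heq : Set.EqOn (fun t => γ⁻¹ * bandTimeLimit W T f t) f (Set.Icc (-T) T) := fun t ht => by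
    simp only [h t ht, inv_mul_cancel_left₀ hγ]
  refine ⟨_, ⟨hγ, (continuous_bandTimeLimit W (hf.intervalIntegrable _ _)).const_mul _,
    fun t => ?_⟩, heq⟩
  rw [mul_inv_cancel_left₀ hγ]
  refine intervalIntegral.integral_congr fun s hs => ?_
  rw [Set.uIcc_of_le (by linarith)] at hs
  simp only [heq hs]

theorem exists_isBandTimeEigen_forall_integral_le (hW : 0 ≤ W) (hT : 0 ≤ T)
    (h : IsBandTimeEigen W T γ f) (hf : f ≠ 0) :
    ∃ γ₀ p, IsBandTimeEigen W T γ₀ p ∧ p ≠ 0 ∧ ∀ g, Continuous g →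
      ∫ t in (-T)..T, bandTimeLimit W T g t * g t ≤ γ₀ * energyInside T g := by
  have hk : Continuous fun q : Set.Icc (-T) T × Set.Icc (-T) T =>
      samplingKernel W (q.1 - q.2) := (continuous_samplingKernel W).comp (by fun_prop)
  have hbandTime (g : ℝ → ℝ) (t : Set.Icc (-T) T) :
      ∫ s : Set.Icc (-T) T, samplingKernel W (t - s) * g s = bandTimeLimit W T g t :=
    integral_Icc_subtype hT fun s => samplingKernel W (t - s) * g s
  have hform (g : ℝ → ℝ) : ∫ t : Set.Icc (-T) T,
      (∫ s : Set.Icc (-T) T, samplingKernel W (t - s) * g s) * g t =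
        ∫ t in (-T)..T, bandTimeLimit W T g t * g t := by
    simp only [hbandTime, ← integral_Icc_subtype hT]
  have hne : ∫ t in (-T)..T, bandTimeLimit W T f t * f t ≠ 0 := by
    simp only [h.bandTimeLimit_eq, mul_assoc, ← pow_two, intervalIntegral.integral_const_mul]
    exact mul_ne_zero h.ne_zero (h.energyInside_pos hW hT hf).ne'
  have : IsFiniteMeasure (volume : Measure (Set.Icc (-T) T)) :=
    ⟨by rw [Measure.Subtype.volume_univ measurableSet_Icc.nullMeasurableSet]
        exact measure_Icc_lt_top⟩
  obtain ⟨m, u, hm, hu, heigen, hle⟩ := exists_eigenfunction_forall_abs_integral_le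
    (μ := volume) (k := ⟨_, hk⟩) (φ₀ := ⟨fun t => f t, h.continuous.comp continuous_subtype_val⟩)
    (fun s t => by simp [← samplingKernel_neg W (s - t)]) (by simpa [hform])
  have hTT : -T ≤ T := by linarith
  have hext (t) (ht : t ∈ Set.Icc (-T) T) :
      bandTimeLimit W T (Set.IccExtend hTT u) t = m * Set.IccExtend hTT u t := by
    simpa [← hbandTime _ ⟨t, ht⟩, Set.IccExtend_of_mem hTT u ht] using heigen ⟨t, ht⟩
  obtain ⟨p, hp, hpu⟩ := exists_isBandTimeEigen_eqOn hT hm u.continuous.Icc_extend' hext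
  have hp0 : p ≠ 0 := by
    rintro rfl
    exact hu (ContinuousMap.ext fun t => by simpa using (hpu t.2).symm)
  refine ⟨m, p, hp, hp0, fun g hg => (le_abs_self _).trans ?_⟩
  simpa [hform, abs_of_pos (hp.eigenvalue_pos hW hT hp0), ← integral_Icc_subtype hT,
    energyInside] using hle ⟨fun t => g t, hg.comp continuous_subtype_val⟩

theorem integral_sq_bandTimeLimit (hW : 0 ≤ W) (T : ℝ) (hg : Continuous g) :
    ∫ t, bandTimeLimit W T g t ^ 2 = ∫ t in (-T)..T, bandTimeLimit W T g t * g t := by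
  simp only [pow_two, mul_comm _ (g _),
    (hasBandSpectrum_bandTimeLimit W T hg).integral_bandTimeLimit_mul hW T hg]

theorem energyInside_le_of_forall_integral_le (hW : 0 ≤ W) (hT : 0 ≤ T) (hγ : 0 ≤ γ)
    (h : ∫ t in (-T)..T, bandTimeLimit W T g t * g t ≤ γ * energyInside T g)
    (hg : HasBandSpectrum W a g) : energyInside T g ≤ γ * ∫ t, g t ^ 2 := by
  have hlim := hasBandSpectrum_bandTimeLimit W T hg.continuous
  have hcs : energyInside T g ≤
      √(∫ t, bandTimeLimit W T g t ^ 2) * √(∫ t, g t ^ 2) :=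
    calc energyInside T g = ∫ t, bandTimeLimit W T g t * g t := by
          simp only [energyInside, pow_two, hg.integral_bandTimeLimit_mul hW T hg.continuous]
      _ ≤ ∫ t, |bandTimeLimit W T g t * g t| :=
          (le_abs_self _).trans abs_integral_le_integral_abs
      _ ≤ _ := integral_abs_mul_le_sqrt_mul_sqrt (hlim.memLp_two hW) (hg.memLp_two hW)
  have hI : 0 ≤ ∫ t, g t ^ 2 := integral_nonneg fun _ => sq_nonneg _
  rw [integral_sq_bandTimeLimit hW T hg.continuous, ← Real.sqrt_mul' _ hI] at hcs
  obtain hE | hE := (energyInside_nonneg hT g).eq_or_lt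
  · rw [← hE]
    positivity
  · have hsq := (Real.le_sqrt' hE).1 hcs
    nlinarith [mul_le_mul_of_nonneg_right h hI]

theorem exists_isBandTimeEigen_forall_energyInside_le (hW : 0 ≤ W) (hT : 0 ≤ T)
    (h : IsBandTimeEigen W T γ f) (hf : f ≠ 0) :
    ∃ γ₀ p, IsBandTimeEigen W T γ₀ p ∧ p ≠ 0 ∧ ∀ a g, HasBandSpectrum W a g →
      energyInside T g ≤ γ₀ * ∫ t, g t ^ 2 := by
  obtain ⟨γ₀, p, hp, hp0, hle⟩ := exists_isBandTimeEigen_forall_integral_le hW hT h hf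
  exact ⟨γ₀, p, hp, hp0, fun a g hg => energyInside_le_of_forall_integral_le hW hT
    (hp.eigenvalue_pos hW hT hp0).le (hle g hg.continuous) hg⟩

end TopEigenvalue

section Division

variable {W : ℝ} {a : ℝ → ℂ} {g : ℝ → ℝ}

/-- The spectral density of `t ↦ g t / (t - z)`, for `g` with spectral density `a` on `[-W, W]` and
`g z = 0`. -/
noncomputable def divisionSpectrum (W : ℝ) (a : ℝ → ℂ) (z : ℂ) (w : ℝ) : ℂ :=
  -Complex.I * Complex.exp (-Complex.I * w * z) *
    ∫ v in (-W)..w, a v * Complex.exp (Complex.I * v * z)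

theorem continuous_divisionSpectrum (W : ℝ) (ha : Continuous a) (z : ℂ) :
    Continuous (divisionSpectrum W a z) := by
  unfold divisionSpectrum
  have hcont : Continuous fun v : ℝ => a v * Complex.exp (Complex.I * v * z) := by fun_prop
  have := intervalIntegral.continuous_primitive (μ := volume)
    (fun _ _ => hcont.intervalIntegrable _ _) (-W)
  fun_prop

/-- Integration by parts: dividing by `t - z` on the time side integrates the spectrum, and the
boundary term at `W` is the value at the zero `z`. -/
theorem sub_mul_bandSynthesis_divisionSpectrum (ha : Continuous a) {z : ℂ}
    (hz : bandSynthesis W a z = 0) (t : ℂ) :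
    (t - z) * bandSynthesis W (divisionSpectrum W a z) t = bandSynthesis W a t := by
  let A (w : ℝ) : ℂ := ∫ v in (-W)..w, a v * Complex.exp (Complex.I * v * z)
  have hA (w : ℝ) : HasDerivAt A (a w * Complex.exp (Complex.I * w * z)) w :=
    (Continuous.integral_hasStrictDerivAt (by fun_prop) (-W) w).hasDerivAt
  have hE (w : ℝ) : HasDerivAt (fun w : ℝ => Complex.exp (Complex.I * w * (t - z)))
      (Complex.I * (t - z) * Complex.exp (Complex.I * w * (t - z))) w := by
    refine ((((hasDerivAt_id' (w : ℂ)).const_mul Complex.I).mul_const (t - z)).cexp.comp_ofReal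
      ).congr_deriv ?_
    ring
  have hparts := intervalIntegral.integral_mul_deriv_eq_deriv_mul (a := -W) (b := W)
    (fun w _ => hA w) (fun w _ => hE w) (Continuous.intervalIntegrable (by fun_prop) _ _)
    (Continuous.intervalIntegrable (by fun_prop) _ _)
  have hAW : A W = 0 := hz
  have hA0 : A (-W) = 0 := intervalIntegral.integral_same
  rw [hAW, hA0, zero_mul, zero_mul, sub_zero, zero_sub] at hparts
  have hleft : (t - z) * bandSynthesis W (divisionSpectrum W a z) t =
      -∫ w in (-W)..W, A w * (Complex.I * (t - z) * Complex.exp (Complex.I * w * (t - z))) := by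
    rw [bandSynthesis, ← intervalIntegral.integral_const_mul, ← intervalIntegral.integral_neg]
    congr 1 with w
    have hexp : Complex.exp (Complex.I * w * (t - z)) =
        Complex.exp (-Complex.I * w * z) * Complex.exp (Complex.I * w * t) := by
      rw [← Complex.exp_add]
      ring_nf
    rw [divisionSpectrum, hexp]
    ring
  rw [hleft, hparts, neg_neg, bandSynthesis]
  congr 1 with w
  rw [mul_assoc, ← Complex.exp_add]
  ring_nf

theorem HasBandSpectrum.dslope {z : ℝ} (h : HasBandSpectrum W a g) (hz : g z = 0) :
    HasBandSpectrum W (divisionSpectrum W a z) (dslope g z) where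
  continuous_spectrum := continuous_divisionSpectrum W h.continuous_spectrum z
  eq_bandSynthesis := by
    have hb := continuous_divisionSpectrum W h.continuous_spectrum z
    have hsyn : bandSynthesis W a z = 0 := by rw [← h.eq_bandSynthesis, hz, Complex.ofReal_zero]
    have hcont : Continuous (_root_.dslope g z) := continuous_iff_continuousAt.2 fun t => by
      obtain rfl | ht := eq_or_ne t z
      · exact continuousAt_dslope_same.2 (h.analyticAt t).differentiableAt
      · exact (continuousAt_dslope_of_ne ht).2 h.continuous.continuousAt
    refine congrFun (Continuous.ext_on (dense_compl_singleton z) (by fun_prop)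
      ((differentiable_bandSynthesis W hb).continuous.comp Complex.continuous_ofReal)
      fun t ht => ?_)
    have htz : (t : ℂ) - z ≠ 0 := sub_ne_zero.2 (Complex.ofReal_injective.ne ht)
    refine mul_left_cancel₀ htz ?_
    rw [sub_mul_bandSynthesis_divisionSpectrum h.continuous_spectrum hsyn, ← h.eq_bandSynthesis,
      ← Complex.ofReal_sub, ← Complex.ofReal_mul, ← smul_eq_mul, sub_smul_dslope, hz, sub_zero]

end Division

section Zeros

variable {W T γ γ' lam z : ℝ} {f g p : ℝ → ℝ}

theorem integral_sq_sub_sq_mul_sq_le (hT : 0 ≤ T)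
    (h_int : Integrable fun t => (T ^ 2 - t ^ 2) * g t ^ 2) :
    ∫ t, (T ^ 2 - t ^ 2) * g t ^ 2 ≤ ∫ t in (-T)..T, (T ^ 2 - t ^ 2) * g t ^ 2 := by
  rw [intervalIntegral.integral_of_le (by linarith), ← integral_Icc_eq_integral_Ioc,
    ← integral_indicator measurableSet_Icc]
  refine integral_mono h_int (h_int.indicator measurableSet_Icc)
    (Set.le_indicator (fun t _ => le_rfl) fun t ht => ?_)
  refine mul_nonpos_of_nonpos_of_nonneg (sub_nonpos.2 ?_) (sq_nonneg _)
  rw [← sq_abs t]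
  exact pow_le_pow_left₀ hT (not_le.1 fun h => ht (abs_le.1 h)).le 2

theorem integral_sub_sq_mul_sq {μ : Measure ℝ} (c : ℝ) (hfg : ∀ t, (t - z) * g t = f t)
    (hf : MemLp f 2 μ) (hg : MemLp g 2 μ) :
    Integrable (fun t => (c - t ^ 2) * g t ^ 2) μ ∧ ∫ t, (c - t ^ 2) * g t ^ 2 ∂μ =
      (c - z ^ 2) * (∫ t, g t ^ 2 ∂μ) - 2 * z * (∫ t, f t * g t ∂μ) - ∫ t, f t ^ 2 ∂μ := by
  have hsplit : (fun t => (c - t ^ 2) * g t ^ 2) =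
      fun t => (c - z ^ 2) * g t ^ 2 - 2 * z * (f t * g t) - f t ^ 2 := by
    funext t
    rw [← hfg]
    ring
  have hfg_int : Integrable (fun t => f t * g t) μ := hf.integrable_mul hg
  have hg_int := hg.integrable_sq.const_mul (c - z ^ 2)
  have hdiff : Integrable (fun t => (c - z ^ 2) * g t ^ 2 - 2 * z * (f t * g t)) μ :=
    hg_int.sub (hfg_int.const_mul _)
  rw [hsplit]
  refine ⟨hdiff.sub hf.integrable_sq, ?_⟩
  rw [integral_sub hdiff hf.integrable_sq, integral_sub hg_int (hfg_int.const_mul _),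
    integral_const_mul, integral_const_mul]

/-- If `p` vanished at `z`, then the weight `1_{[-T, T]} - γ` would integrate to zero against
`p ^ 2` and against `p * g`, where `g t = p t / (t - z)`. As
`(T ^ 2 - t ^ 2) * g ^ 2 = (T ^ 2 - z ^ 2) * g ^ 2 - 2 * z * p * g - p ^ 2`, maximality for `g`
would make its integral against the weight nonpositive. -/
theorem IsBandTimeEigen.apply_ne_zero_of_forall_energyInside_le (hW : 0 ≤ W) (hT : 0 < T)
    (h : IsBandTimeEigen W T γ p) (hp : p ≠ 0)
    (hmax : ∀ a g, HasBandSpectrum W a g → energyInside T g ≤ γ * ∫ t, g t ^ 2)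
    (hz : z ∈ Set.Icc (-T) T) : p z ≠ 0 := by
  intro hpz
  have hTT : -T ≤ T := by linarith
  have hg := h.hasBandSpectrum.dslope hpz
  set g := dslope p z
  have hpg (t) : (t - z) * g t = p t := by simpa [hpz] using sub_smul_dslope p z t
  have hp₂ := h.memLp_two hW
  have hg₂ := hg.memLp_two hW
  obtain ⟨h_int, hline⟩ := integral_sub_sq_mul_sq (T ^ 2) hpg hp₂ hg₂
  have hinside := (integral_sub_sq_mul_sq (T ^ 2) hpg (hp₂.restrict (Set.Ioc (-T) T))
    (hg₂.restrict _)).2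
  simp only [← intervalIntegral.integral_of_le hTT] at hinside
  have hle : ∫ t in (-T)..T, (T ^ 2 - t ^ 2) * g t ^ 2 ≤ γ * ∫ t, (T ^ 2 - t ^ 2) * g t ^ 2 := by
    have hEp := h.energyInside_eq hW
    have hEg := hmax _ _ hg
    rw [energyInside] at hEp hEg
    rw [hinside, hline, hEp, h.integral_mul_eq hW hg]
    nlinarith [sq_le_sq' hz.1 hz.2]
  have hpos : 0 < ∫ t in (-T)..T, (T ^ 2 - t ^ 2) * g t ^ 2 := by
    obtain ⟨t, hpt, htT⟩ : ∃ t, p t ≠ 0 ∧ t ∈ Set.Ioo (-T) T :=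
      ((Filter.not_eventually.1 (mt h.eq_zero_of_eventually hp)).and_eventually
        (Ioo_mem_nhds (neg_neg_iff_pos.2 hT) hT)).exists
    have hgt : g t ≠ 0 := right_ne_zero_of_mul (hpg t ▸ hpt)
    have hgc := hg.continuous
    refine intervalIntegral.integral_pos (by linarith) (by fun_prop) (fun s hs => ?_)
      ⟨t, Set.Ioo_subset_Icc_self htT, ?_⟩
    · exact mul_nonneg (sub_nonneg.2 (sq_le_sq' hs.1.le hs.2)) (sq_nonneg _)
    · exact mul_pos (sub_pos.2 (sq_lt_sq' htT.1 htT.2)) (by positivity)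
  nlinarith [integral_sq_sub_sq_mul_sq_le hT.le h_int, h.eigenvalue_pos hW hT.le hp,
    h.eigenvalue_lt_one hW hT.le hp]

theorem exists_eq_zero_of_integral_mul_eq_zero {q : ℝ → ℝ} {a b : ℝ} (hab : a < b)
    (hf : Continuous f) (hq : Continuous q) (hq0 : ∀ t ∈ Set.Ioo a b, q t ≠ 0)
    (h : ∫ t in a..b, q t * f t = 0) : ∃ t ∈ Set.Icc a b, f t = 0 := by
  obtain ⟨t, ht, heq⟩ := exists_eq_interval_average hab.ne (hq.mul hf).continuousOn
  rw [Set.uIoo_of_lt hab] at ht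
  simp only [Pi.mul_apply, interval_average_eq, h, smul_zero] at heq
  exact ⟨t, Set.Ioo_subset_Icc_self ht, (mul_eq_zero.1 heq).resolve_left (hq0 t ht)⟩

theorem IsBandTimeEigen.exists_eq_zero_of_lt (hW : 0 ≤ W) (hT : 0 < T)
    (h : IsBandTimeEigen W T γ f) (h' : IsBandTimeEigen W T γ' g) (hg : g ≠ 0) (hlt : γ < γ') :
    ∃ z ∈ Set.Icc (-T) T, f z = 0 := by
  obtain ⟨γ₀, p, hp, hp0, hmax⟩ := exists_isBandTimeEigen_forall_energyInside_le hW hT.le h' hg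
  have hle : γ' ≤ γ₀ := by
    have := hmax _ _ h'.hasBandSpectrum
    rw [h'.energyInside_eq hW] at this
    exact le_of_mul_le_mul_right this (h'.integral_sq_pos hW hg)
  exact exists_eq_zero_of_integral_mul_eq_zero (by linarith) h.continuous hp.continuous
    (fun t ht => hp.apply_ne_zero_of_forall_energyInside_le hW hT hp0 hmax
      (Set.Ioo_subset_Icc_self ht)) (hp.integral_mul_eq_zero h (hlt.trans_le hle).ne')

theorem SolvesPSWEq.exists_eq_zero (hW : W ≠ 0) (hT : 0 < T) (hf : ContDiff ℝ 2 f)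
    (hl : SolvesPSWEq W T lam f) (hlam : 0 ≤ lam) : ∃ z ∈ Set.Icc (-T) T, f z = 0 := by
  refine exists_eq_zero_of_integral_mul_eq_zero (by linarith) hf.continuous (by fun_prop)
    (fun t ht => ne_of_gt ?_) (hl.integral_weight_mul hf)
  have : 0 < T ^ 2 - t ^ 2 := sub_pos.2 (sq_lt_sq' ht.1 ht.2)
  positivity

end Zeros

section Constants

variable {W T γ lam : ℝ} {n : ℕ} {f ξ : ℝ → ℝ}

theorem IsBandTimeEigen.energyOutside_deriv_eq (hW : 0 ≤ W) (hT : 0 < T)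
    (h : IsBandTimeEigen W T γ f) (hl : SolvesPSWEq W T lam f) :
    energyOutside T (deriv f) = (1 - γ) * (∫ t, deriv f t ^ 2) - lam / T * f T ^ 2 := by
  linear_combination energyInside_add_energyOutside hT.le (h.memLp_two_deriv hW) -
    h.energyInside_deriv_eq hW hT.ne' hl

theorem lineNorm_nonneg (f : ℝ → ℝ) : 0 ≤ lineNorm f := Real.sqrt_nonneg _

theorem CBase_neg (T lam : ℝ) (f : ℝ → ℝ) : CBase T (-lam) f = CBase T lam f := by
  rw [CBase, neg_sq, CBase]

theorem le_CBase_add_of_sq_le {C : ℝ} (h : C ^ 2 ≤ lineNorm (deriv f) ^ 2 + lam / T * C) :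
    C ≤ CBase T lam f + lam / (2 * T) := by
  have hsquare : (C - lam / (2 * T)) ^ 2 ≤ lineNorm (deriv f) ^ 2 + lam ^ 2 / (4 * T ^ 2) := by
    linear_combination h
  exact sub_le_iff_le_add.1 (Real.le_sqrt_of_sq_le hsquare)

theorem CBase_le (hW : 0 ≤ W) (hf : lineNorm (deriv f) ≤ W) (hlam : |lam| ≤ W ^ 2 * T ^ 2) :
    CBase T lam f ≤ W * √(1 + (W * T) ^ 2 / 4) := by
  refine Real.sqrt_le_iff.2 ⟨by positivity, ?_⟩
  rw [mul_pow, Real.sq_sqrt (by positivity), mul_add, mul_one]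
  refine add_le_add (pow_le_pow_left₀ (lineNorm_nonneg _) hf 2) ?_
  refine div_le_of_le_mul₀ (by positivity) (by positivity) ?_
  calc lam ^ 2 = |lam| ^ 2 := (sq_abs lam).symm
    _ ≤ (W ^ 2 * T ^ 2) ^ 2 := pow_le_pow_left₀ (abs_nonneg lam) hlam 2
    _ = W ^ 2 * ((W * T) ^ 2 / 4) * (4 * T ^ 2) := by ring

theorem sqrt_one_add_sq_div_four_lt {c : ℝ} (hc : 0 < c) : √(1 + c ^ 2 / 4) < c / 2 + 1 / c := by
  refine (Real.sqrt_lt' (by positivity)).2 ?_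
  have hsq : (c / 2 + 1 / c) ^ 2 = 1 + c ^ 2 / 4 + (1 / c) ^ 2 := by
    field_simp
    ring
  rw [hsq]
  exact lt_add_of_pos_right _ (by positivity)

namespace IsProlate

theorem isBandTimeEigen (h : IsProlate W T n γ ξ) : IsBandTimeEigen W T γ ξ :=
  h.1.isBandTimeEigen

theorem ne_zero (h : IsProlate W T n γ ξ) : ξ ≠ 0 := h.1.2.2.1

theorem eigenvalue_pos (hW : 0 ≤ W) (hT : 0 ≤ T) (h : IsProlate W T n γ ξ) : 0 < γ :=
  h.isBandTimeEigen.eigenvalue_pos hW hT h.ne_zero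

theorem eigenvalue_lt_one (hW : 0 ≤ W) (hT : 0 ≤ T) (h : IsProlate W T n γ ξ) : γ < 1 :=
  h.isBandTimeEigen.eigenvalue_lt_one hW hT h.ne_zero

theorem contDiff (h : IsProlate W T n γ ξ) {m : WithTop ℕ∞} : ContDiff ℝ m ξ :=
  h.isBandTimeEigen.contDiff

theorem memLp_two_deriv (hW : 0 ≤ W) (h : IsProlate W T n γ ξ) : MemLp (deriv ξ) 2 :=
  h.isBandTimeEigen.memLp_two_deriv hW

theorem existsUnique_solvesPSWEq (hT : T ≠ 0) (h : IsProlate W T n γ ξ) :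
    ∃! lam : ℝ, SolvesPSWEq W T lam ξ :=
  h.isBandTimeEigen.existsUnique_solvesPSWEq hT h.ne_zero

theorem lineNorm_deriv_lt (hW : 0 < W) (h : IsProlate W T n γ ξ) : lineNorm (deriv ξ) < W := by
  rw [lineNorm, Real.sqrt_lt' hW]
  simpa only [h.2.1, mul_one] using
    h.isBandTimeEigen.hasBandSpectrum.integral_deriv_sq_lt hW.le h.ne_zero

theorem energyInside_eq (hW : 0 ≤ W) (h : IsProlate W T n γ ξ) : energyInside T ξ = γ := by
  rw [h.isBandTimeEigen.energyInside_eq hW, h.2.1, mul_one]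

theorem energyOutside_eq (hW : 0 ≤ W) (hT : 0 ≤ T) (h : IsProlate W T n γ ξ) :
    energyOutside T ξ = 1 - γ := by
  rw [← h.energyInside_eq hW, ← h.2.1, ← energyInside_add_energyOutside hT h.1.2.1,
    add_sub_cancel_left]

theorem CIntra_sq (hW : 0 ≤ W) (hT : 0 < T) (h : IsProlate W T n γ ξ)
    (hl : SolvesPSWEq W T lam ξ) :
    CIntra T γ lam ξ ^ 2 = lineNorm (deriv ξ) ^ 2 + lam / T * (ξ T ^ 2 / γ) := by
  have hγ := h.eigenvalue_pos hW hT.le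
  have henergy := h.isBandTimeEigen.energyInside_deriv_eq hW hT.ne' hl
  have hdiv : lineNorm (deriv ξ) ^ 2 + lam / T * (ξ T ^ 2 / γ) = energyInside T (deriv ξ) / γ := by
    rw [henergy, lineNorm_sq]
    field_simp
  refine Real.sq_sqrt ?_
  rw [hdiv]
  exact div_nonneg (energyInside_nonneg hT.le _) hγ.le

theorem energyInside_deriv_eq (hW : 0 ≤ W) (hT : 0 < T) (h : IsProlate W T n γ ξ)
    (hl : SolvesPSWEq W T lam ξ) : energyInside T (deriv ξ) = γ * CIntra T γ lam ξ ^ 2 := by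
  have hγ := (h.eigenvalue_pos hW hT.le).ne'
  rw [h.CIntra_sq hW hT hl, h.isBandTimeEigen.energyInside_deriv_eq hW hT.ne' hl, lineNorm_sq]
  field_simp

theorem CExtra_sq (hW : 0 ≤ W) (hT : 0 < T) (h : IsProlate W T n γ ξ)
    (hl : SolvesPSWEq W T lam ξ) :
    CExtra T γ lam ξ ^ 2 = lineNorm (deriv ξ) ^ 2 - lam / T * (ξ T ^ 2 / (1 - γ)) := by
  have hγ : 0 < 1 - γ := sub_pos.2 (h.eigenvalue_lt_one hW hT.le)
  have henergy := h.isBandTimeEigen.energyOutside_deriv_eq hW hT hl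
  have hdiv : lineNorm (deriv ξ) ^ 2 - lam / T * (ξ T ^ 2 / (1 - γ)) =
      energyOutside T (deriv ξ) / (1 - γ) := by
    rw [henergy, lineNorm_sq]
    field_simp
  refine Real.sq_sqrt ?_
  rw [hdiv]
  exact div_nonneg (energyOutside_nonneg T _) hγ.le

theorem energyOutside_deriv_eq (hW : 0 ≤ W) (hT : 0 < T) (h : IsProlate W T n γ ξ)
    (hl : SolvesPSWEq W T lam ξ) :
    energyOutside T (deriv ξ) = (1 - γ) * CExtra T γ lam ξ ^ 2 := by
  have hγ : 1 - γ ≠ 0 := (sub_pos.2 (h.eigenvalue_lt_one hW hT.le)).ne'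
  rw [h.CExtra_sq hW hT hl, h.isBandTimeEigen.energyOutside_deriv_eq hW hT hl, lineNorm_sq]
  field_simp

theorem sq_le_CExtra (hW : 0 ≤ W) (hT : 0 < T) (h : IsProlate W T n γ ξ)
    (hl : SolvesPSWEq W T lam ξ) {t : ℝ} (ht : T ≤ |t|) :
    ξ t ^ 2 ≤ (1 - γ) * CExtra T γ lam ξ := by
  have hγ : 0 ≤ 1 - γ := (sub_pos.2 (h.eigenvalue_lt_one hW hT.le)).le
  have hsup := sq_le_sqrt_energyOutside_mul h.contDiff (h.isBandTimeEigen.even_sq hT.ne') h.1.2.1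
    (h.memLp_two_deriv hW) ht
  rwa [h.energyOutside_eq hW hT.le, h.energyOutside_deriv_eq hW hT hl, Real.sqrt_mul hγ,
    ← mul_assoc, Real.mul_self_sqrt hγ,
    Real.sqrt_sq (show 0 ≤ CExtra T γ lam ξ from Real.sqrt_nonneg _)] at hsup

theorem sq_sub_sq_le_CIntra (hW : 0 ≤ W) (hT : 0 < T) (h : IsProlate W T n γ ξ)
    (hl : SolvesPSWEq W T lam ξ) {z t : ℝ} (hz : |z| ≤ T) (ht : |t| ≤ T) :
    ξ t ^ 2 - ξ z ^ 2 ≤ γ * CIntra T γ lam ξ := by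
  have hγ := (h.eigenvalue_pos hW hT.le).le
  have hsup := sq_sub_sq_le_sqrt_energyInside_mul h.contDiff (h.isBandTimeEigen.even_sq hT.ne')
    hz ht
  rwa [h.energyInside_eq hW, h.energyInside_deriv_eq hW hT hl, Real.sqrt_mul hγ,
    ← mul_assoc, Real.mul_self_sqrt hγ,
    Real.sqrt_sq (show 0 ≤ CIntra T γ lam ξ from Real.sqrt_nonneg _)] at hsup

theorem sq_le_CIntra_of_exists_eq_zero (hW : 0 ≤ W) (hT : 0 < T) (h : IsProlate W T n γ ξ)
    (hl : SolvesPSWEq W T lam ξ) (hzero : ∃ z ∈ Set.Icc (-T) T, ξ z = 0) {t : ℝ} (ht : |t| ≤ T) :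
    ξ t ^ 2 ≤ γ * CIntra T γ lam ξ := by
  obtain ⟨z, hz, hξz⟩ := hzero
  simpa [hξz] using h.sq_sub_sq_le_CIntra hW hT hl (abs_le.2 hz) ht

theorem exists_eq_zero (hW : 0 ≤ W) (hT : 0 < T) (h : IsProlate W T n γ ξ) (hn : n ≠ 0) :
    ∃ z ∈ Set.Icc (-T) T, ξ z = 0 := by
  obtain ⟨γ', hlt, f, hf⟩ := Set.encard_ne_zero.1 (h.2.2.trans_ne (by exact_mod_cast hn))
  exact h.isBandTimeEigen.exists_eq_zero_of_lt hW hT hf.isBandTimeEigen hf.2.2.1 hlt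

theorem sq_le_CIntraTilde (hW : 0 ≤ W) (hT : 0 < T) (h : IsProlate W T n γ ξ)
    (hl : SolvesPSWEq W T lam ξ) {t : ℝ} (ht : |t| ≤ T) :
    ξ t ^ 2 ≤ γ * CIntraTilde T n γ lam ξ := by
  rw [CIntraTilde]
  split_ifs with hn
  · rw [mul_add, mul_div_cancel₀ _ (h.eigenvalue_pos hW hT.le).ne', ← sub_le_iff_le_add]
    exact h.sq_sub_sq_le_CIntra hW hT hl (abs_of_pos hT).le ht
  · rw [add_zero]
    exact h.sq_le_CIntra_of_exists_eq_zero hW hT hl (h.exists_eq_zero hW hT hn) ht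

theorem CExtra_le_CBase (hW : 0 ≤ W) (hT : 0 < T) (h : IsProlate W T n γ ξ)
    (hl : SolvesPSWEq W T lam ξ) (hlam : lam ≤ 0) :
    CExtra T γ lam ξ ≤ CBase T lam ξ - lam / (2 * T) := by
  have hboundary : ξ T ^ 2 / (1 - γ) ≤ CExtra T γ lam ξ :=
    (div_le_iff₀' (sub_pos.2 (h.eigenvalue_lt_one hW hT.le))).2
      (h.sq_le_CExtra hW hT hl (abs_of_pos hT).ge)
  rw [sub_eq_add_neg, ← neg_div, ← CBase_neg]
  refine le_CBase_add_of_sq_le ?_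
  rw [h.CExtra_sq hW hT hl, sub_eq_add_neg, ← neg_mul, ← neg_div]
  gcongr
  exact div_nonneg (neg_nonneg.2 hlam) hT.le

theorem CIntra_le_CBase (hW : 0 < W) (hT : 0 < T) (h : IsProlate W T n γ ξ)
    (hl : SolvesPSWEq W T lam ξ) (hlam : 0 ≤ lam) :
    CIntra T γ lam ξ ≤ CBase T lam ξ + lam / (2 * T) := by
  have hboundary : ξ T ^ 2 / γ ≤ CIntra T γ lam ξ :=
    (div_le_iff₀' (h.eigenvalue_pos hW.le hT.le)).2
      (h.sq_le_CIntra_of_exists_eq_zero hW.le hT hl (hl.exists_eq_zero hW.ne' hT h.contDiff hlam)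
        (abs_of_pos hT).le)
  refine le_CBase_add_of_sq_le ?_
  rw [h.CIntra_sq hW.le hT hl]
  gcongr

theorem CExtra_le_of_nonpos (hW : 0 < W) (hT : 0 < T) (h : IsProlate W T n γ ξ)
    (hl : SolvesPSWEq W T lam ξ) (hlam : lam ≤ 0) :
    CExtra T γ lam ξ ≤ W * (√(1 + (W * T) ^ 2 / 4) + W * T / 2) := by
  have hneg : -lam ≤ W ^ 2 * T ^ 2 := hl.neg_le hT.le h.contDiff
    (h.isBandTimeEigen.energyInside_pos hW.le hT.le h.ne_zero)
  have hbase : CBase T lam ξ ≤ W * √(1 + (W * T) ^ 2 / 4) :=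
    CBase_le hW.le (h.lineNorm_deriv_lt hW).le (by rwa [abs_of_nonpos hlam])
  have hshift : -(lam / (2 * T)) ≤ W * (W * T / 2) := by
    rw [← neg_div, div_le_iff₀ (by positivity)]
    linarith
  linarith [h.CExtra_le_CBase hW.le hT hl hlam]

theorem CExtra_lt_of_nonpos (hW : 0 < W) (hT : 0 < T) (h : IsProlate W T n γ ξ)
    (hl : SolvesPSWEq W T lam ξ) (hlam : lam ≤ 0) :
    CExtra T γ lam ξ < W * (W * T + 1 / (W * T)) := by
  refine (h.CExtra_le_of_nonpos hW hT hl hlam).trans_lt (mul_lt_mul_of_pos_left ?_ hW)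
  linarith [sqrt_one_add_sq_div_four_lt (mul_pos hW hT)]

theorem CIntra_lt_of_neg (hW : 0 ≤ W) (hT : 0 < T) (h : IsProlate W T n γ ξ)
    (hl : SolvesPSWEq W T lam ξ) (hlam : lam < 0) :
    CIntra T γ lam ξ < lineNorm (deriv ξ) := by
  refine lt_of_pow_lt_pow_left₀ 2 (lineNorm_nonneg _) ?_
  have hξT := h.isBandTimeEigen.apply_ne_zero hT.ne' h.ne_zero
  have hγ := h.eigenvalue_pos hW hT.le
  rw [h.CIntra_sq hW hT hl]
  have hslope : lam / T < 0 := div_neg_of_neg_of_pos hlam hT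
  exact add_lt_of_neg_right _ (mul_neg_of_neg_of_pos hslope (by positivity))

theorem CExtra_le_of_nonneg (hW : 0 ≤ W) (hT : 0 < T) (h : IsProlate W T n γ ξ)
    (hl : SolvesPSWEq W T lam ξ) (hlam : 0 ≤ lam) : CExtra T γ lam ξ ≤ lineNorm (deriv ξ) := by
  have hγ := sub_pos.2 (h.eigenvalue_lt_one hW hT.le)
  refine le_of_sq_le_sq ?_ (lineNorm_nonneg _)
  rw [h.CExtra_sq hW hT hl]
  exact sub_le_self _ (by positivity)

end IsProlate

end Constants

theorem mainTheorem1 :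
    (∀ (W T : ℝ), 0 < W → 0 < T → ∀ (n : ℕ) (γ : ℝ) (ξ : ℝ → ℝ), IsProlate W T n γ ξ →
      -- all quantities below are well defined
      (0 < γ ∧ γ < 1) ∧ ContDiff ℝ ∞ ξ ∧ MemLp (deriv ξ) 2 volume ∧
      (∃! lam : ℝ, SolvesPSWEq W T lam ξ) ∧
      lineNorm (deriv ξ) < W ∧
      ∀ lam : ℝ, SolvesPSWEq W T lam ξ →
        -- derivative energies
        energyInside T (deriv ξ) = γ * CIntra T γ lam ξ ^ 2 ∧
        energyOutside T (deriv ξ) = (1 - γ) * CExtra T γ lam ξ ^ 2 ∧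
        -- supremum bounds
        (∀ t : ℝ, T ≤ |t| → ξ t ^ 2 ≤ (1 - γ) * CExtra T γ lam ξ) ∧
        (∀ t : ℝ, |t| ≤ T → ξ t ^ 2 ≤ γ * CIntraTilde T n γ lam ξ) ∧
        -- bounds for the constants
        (lam < 0 →
          CExtra T γ lam ξ ≤ CBase T lam ξ - lam / (2 * T) ∧
          CExtra T γ lam ξ ≤ W * (Real.sqrt (1 + (W * T) ^ 2 / 4) + W * T / 2) ∧
          CIntra T γ lam ξ < lineNorm (deriv ξ) ∧
          CIntra T γ lam ξ < W) ∧
        (0 ≤ lam →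
          CExtra T γ lam ξ ≤ lineNorm (deriv ξ) ∧
          CExtra T γ lam ξ < W ∧
          CIntra T γ lam ξ ≤ CBase T lam ξ + lam / (2 * T))) ∧
    -- large `c = W T`, uniformly in `W`, `T` and `n`
    (∃ K c₀ : ℝ, 0 < c₀ ∧ ∀ (W T : ℝ), 0 < W → 0 < T → c₀ ≤ W * T →
      ∀ (n : ℕ) (γ : ℝ) (ξ : ℝ → ℝ) (lam : ℝ), IsProlate W T n γ ξ → SolvesPSWEq W T lam ξ →
        lam < 0 →
        CExtra T γ lam ξ < W * (W * T + 1 / (W * T) + K / (W * T) ^ 2)) := by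
  refine ⟨fun W T hW hT n γ ξ h => ?_, 0, 1, one_pos, fun W T hW hT _ n γ ξ lam h hl hlam => ?_⟩
  · have hlt := h.lineNorm_deriv_lt hW
    refine ⟨⟨h.eigenvalue_pos hW.le hT.le, h.eigenvalue_lt_one hW.le hT.le⟩, h.contDiff,
      h.memLp_two_deriv hW.le, h.existsUnique_solvesPSWEq hT.ne', hlt, fun lam hl => ?_⟩
    refine ⟨h.energyInside_deriv_eq hW.le hT hl, h.energyOutside_deriv_eq hW.le hT hl,
      fun t ht => h.sq_le_CExtra hW.le hT hl ht, fun t ht => h.sq_le_CIntraTilde hW.le hT hl ht,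
      fun hlam => ?_, fun hlam => ?_⟩
    · have hintra := h.CIntra_lt_of_neg hW.le hT hl hlam
      exact ⟨h.CExtra_le_CBase hW.le hT hl hlam.le, h.CExtra_le_of_nonpos hW hT hl hlam.le,
        hintra, hintra.trans hlt⟩
    · have hextra := h.CExtra_le_of_nonneg hW.le hT hl hlam
      exact ⟨hextra, hextra.trans_lt hlt, h.CIntra_le_CBase hW hT hl hlam⟩
  · simpa using h.CExtra_lt_of_nonpos hW hT hl hlam.le
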